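/- **Proposition 5.1.** Let $G=H_3(\mathbb Z)$ be the discrete Heisenberg group, i.e. the set $\mathbb Z^3$ with the multiplication $$(x_1,y_1,z_1)(x_2,y_2,z_2)=(x_1+x_2,\;y_1+y_2,\;z_1+z_2+x_1y_2),$$ and let $\pi:G\to\mathbb Z^2$, $\pi(x,y,z)=(x,y)$. Let $S\subset G$ be a finite symmetric generating set ($S=S^{-1}$), and put $\bar S=\pi(S)$, a finite symmetric generating set of $\mathbb Z^2$. Let $|\cdot|_S$ and $|\cdot|_{\bar S}$ denote the word norms on $G$ and on $\mathbb Z^2$ with respect to $S$ and $\bar S$. Let $$\gamma=\gamma_{\bar S}=\sup_{P}\frac{a(P)}{l(P)^2}$$ be the isoperimetric constant of $\bar S$, where $P=(u_1,\dots,u_n)$ runs over all nonempty finite sequences of elements of $\bar S$ with $u_1+\dots+u_n=0$, $l(P)=n$, and $a(P)=\frac12\sum_{i<j}\det(u_i,u_j)$ is the signed area of the closed polygon with successive edges $u_1,\dots,u_n$. Then there exist constants $L,C\ge 0$ (depending only on $S$) such that for every $(x,y,z)\in G$, $$|z|\ge L\max\{x^4,y^4\}\quad\Longrightarrow\quad \left|\,|(x,y,z)|_S-\left(\sqrt{\frac{|z|}{\gamma}}-|(x,y)|_{\bar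 S}\right)\right|\le C .$$ -/

import Mathlib

/-- The discrete Heisenberg group `H₃(ℤ)`, as a set `ℤ³`. -/
@[ext]
structure Heis where
  x : ℤ
  y : ℤ
  z : ℤ

namespace Heis

/-- `(x₁,y₁,z₁)(x₂,y₂,z₂) = (x₁+x₂, y₁+y₂, z₁+z₂+x₁y₂)`. -/
instance : Mul Heis := ⟨fun g h => ⟨g.x + h.x, g.y + h.y, g.z + h.z + g.x * h.y⟩⟩

instance : One Heis := ⟨⟨0, 0, 0⟩⟩

instance : Inv Heis := ⟨fun g => ⟨-g.x, -g.y, g.x * g.y - g.z⟩⟩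

@[simp] theorem mul_x (g h : Heis) : (g * h).x = g.x + h.x := rfl

@[simp] theorem mul_y (g h : Heis) : (g * h).y = g.y + h.y := rfl

@[simp] theorem mul_z (g h : Heis) : (g * h).z = g.z + h.z + g.x * h.y := rfl

@[simp] theorem one_x : (1 : Heis).x = 0 := rfl

@[simp] theorem one_y : (1 : Heis).y = 0 := rfl

@[simp] theorem one_z : (1 : Heis).z = 0 := rfl

@[simp] theorem inv_x (g : Heis) : (g⁻¹).x = -g.x := rfl

@[simp] theorem inv_y (g : Heis) : (g⁻¹).y = -g.y := rfl

@[simp] theorem inv_z (g : Heis) : (g⁻¹).z = g.x * g.y - g.z := rfl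

instance : Group Heis := Group.ofLeftAxioms
  (fun a b c => by ext <;> simp <;> ring)
  (fun a => by ext <;> simp)
  (fun a => by ext <;> simp)

/-- The abelianization map `H₃(ℤ) → ℤ²`, `(x,y,z) ↦ (x,y)`. -/
def proj (g : Heis) : ℤ × ℤ := (g.x, g.y)

end Heis

/-- The word norm of `g` with respect to `S`: the least length of a word in `S` whose product
is `g`. (It is used for symmetric generating sets `S`, where such words exist for all `g`.) -/
noncomputable def wordNorm {G : Type*} [Group G] (S : Set G) (g : G) : ℕ :=
  sInf {n : ℕ | ∃ w : List G, (∀ s ∈ w, s ∈ S) ∧ w.prod = g ∧ w.length = n}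

/-- The word norm in an additively written group. -/
noncomputable def addWordNorm {A : Type*} [AddGroup A] (V : Set A) (a : A) : ℕ :=
  sInf {n : ℕ | ∃ w : List A, (∀ v ∈ w, v ∈ V) ∧ w.sum = a ∧ w.length = n}

/-- The determinant `det(u, v)` of two vectors of `ℤ²`. -/
def planeDet (u v : ℤ × ℤ) : ℤ := u.1 * v.2 - u.2 * v.1

/-- For a word `(u₁, …, uₙ)` in `ℤ²`, the sum `∑_{i<j} det(uᵢ, uⱼ)`. -/
def detSum : List (ℤ × ℤ) → ℤ
  | [] => 0
  | u :: P => (P.map (planeDet u)).sum + detSum P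

/-- A `V`-polygon: a nonempty word in `V` whose letters sum to zero. -/
def IsPolygon (V : Set (ℤ × ℤ)) (P : List (ℤ × ℤ)) : Prop :=
  P ≠ [] ∧ (∀ v ∈ P, v ∈ V) ∧ P.sum = 0

/-- The signed Euclidean area `a(P) = ½ ∑_{i<j} det(uᵢ, uⱼ)` of `P = (u₁, …, uₙ)`. -/
noncomputable def signedArea (P : List (ℤ × ℤ)) : ℝ := (detSum P : ℝ) / 2

/-- The isoperimetric constant `γ_V`: the supremum of `a(P) / l(P)²` over all `V`-polygons `P`,
where `l(P)` is the number of edges. -/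
noncomputable def isoperimetricConstant (V : Set (ℤ × ℤ)) : ℝ :=
  sSup {r : ℝ | ∃ P : List (ℤ × ℤ), IsPolygon V P ∧ r = signedArea P / (P.length : ℝ) ^ 2}

/-- For finite `V` the supremum in the definition of the isoperimetric constant is over a set
that is bounded above. -/
theorem bddAbove_isoperimetric {V : Set (ℤ × ℤ)} (hV : V.Finite) :
    BddAbove {r : ℝ | ∃ P : List (ℤ × ℤ), IsPolygon V P ∧
      r = signedArea P / (P.length : ℝ) ^ 2} := by
  obtain ⟨M, hM⟩ := ((hV.prod hV).image (fun p => planeDet p.1 p.2)).bddAbove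
  have hdet : ∀ u ∈ V, ∀ v ∈ V, planeDet u v ≤ max M 0 := fun u hu v hv =>
    le_max_of_le_left (hM ⟨(u, v), ⟨hu, hv⟩, rfl⟩)
  have hrow : ∀ u ∈ V, ∀ P : List (ℤ × ℤ), (∀ v ∈ P, v ∈ V) →
      (P.map (planeDet u)).sum ≤ max M 0 * P.length := by
    intro u hu P
    induction P with
    | nil => simp
    | cons v P ih =>
      intro h
      have h1 := hdet u hu v (h v (by simp))
      have h2 := ih (fun w hw => h w (by simp [hw]))
      simp only [List.map_cons, List.sum_cons, List.length_cons]
      push_cast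
      linarith
  have hsum : ∀ P : List (ℤ × ℤ), (∀ v ∈ P, v ∈ V) →
      detSum P ≤ max M 0 * (P.length : ℤ) ^ 2 := by
    intro P
    induction P with
    | nil => simp [detSum]
    | cons v P ih =>
      intro h
      have h1 := hrow v (h v (by simp)) P (fun w hw => h w (by simp [hw]))
      have h2 := ih (fun w hw => h w (by simp [hw]))
      have h0 : 0 ≤ max M 0 := le_max_right _ _
      simp only [detSum, List.length_cons]
      push_cast
      nlinarith [mul_nonneg h0 (Int.natCast_nonneg P.length)]
  refine ⟨((max M 0 : ℤ) : ℝ), ?_⟩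
  rintro r ⟨P, ⟨hne, hPV, -⟩, rfl⟩
  have hl : 0 < (P.length : ℝ) := by exact_mod_cast List.length_pos_iff.mpr hne
  rw [div_le_iff₀ (by positivity), signedArea]
  have h1 : (detSum P : ℝ) ≤ ((max M 0 : ℤ) : ℝ) * (P.length : ℝ) ^ 2 := by
    exact_mod_cast hsum P hPV
  have h0 : (0 : ℝ) ≤ ((max M 0 : ℤ) : ℝ) := by exact_mod_cast le_max_right M 0
  nlinarith [mul_nonneg h0 (sq_nonneg (P.length : ℝ))]

/-! Twice the central coordinate of a word differs from `detSum` of its projected path, a signed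
area, by xy plus an error linear in the length. When |x|, |y| ≤ |z|^(1/4), |xy| is at most √|z|. An
area error of order √|z| costs only O(1) in length, because area grows quadratically. It therefore
suffices to compare length and area up to errors linear in n ~ √|z|.

Lower bound (`Heis.exists_lower_bound`): close the projection of a geodesic for (x,y,z) by a
geodesic back from (x,y). The result is a polygon of length |(x,y,z)| + |(x,y)| and area |z| +
O(√|z|) up to sign, up to a further error linear in its length. The isoperimetric inequality then
bounds √(|z|/γ).

Upper bound (`Heis.exists_upper_bound`): with real edge multiplicities, a closed polygon of weight
one and maximal area exists by compactness (`WeightedWord.exists_optimal`), and its corners turn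
left, so that every vector lies in the cone of two adjacent edges (`IsOptimal.exists_corner`). Scale
it to perimeter n, write -(x,y) = a u + b v with u, v adjacent edges, and cut off a of u and b of v
at their common corner (`IsOptimal.exists_cut`). The path now ends at (x,y), has length n - a - b,
and has lost area O(ab) = O(n). Since |(x,y)| ≤ a + b + O(1), this length is at most n - |(x,y)| +
O(1). Rounding the multiplicities costs O(1) in the endpoint and O(n) in area. The central error
O(n) is removed by one inserted commutator: an element e of bounded size placed inside the word,
with its inverse at the end, shifts the center by det(e, suffix), which can be as large as order n
(`Heis.exists_insertion`). -/

/-! ### Signed areas of words with real multiplicities. -/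

/-- The determinant of two vectors of the real plane. -/
def realDet (u v : ℝ × ℝ) : ℝ := u.1 * v.2 - u.2 * v.1

/-- The sum `∑_{i<j} det(uᵢ, uⱼ)` of a word in the real plane. -/
def realDetSum : List (ℝ × ℝ) → ℝ
  | [] => 0
  | u :: P => realDet u P.sum + realDetSum P

theorem realDetSum_append (A B : List (ℝ × ℝ)) :
    realDetSum (A ++ B) = realDetSum A + realDetSum B + realDet A.sum B.sum := by
  induction A with
  | nil => simp [realDetSum, realDet]
  | cons u A ih =>
    simp only [List.cons_append, realDetSum, ih, List.sum_append, List.sum_cons, realDet,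
      Prod.fst_add, Prod.snd_add]
    ring

theorem realDetSum_reverse (A : List (ℝ × ℝ)) : realDetSum A.reverse = - realDetSum A := by
  induction A with
  | nil => simp [realDetSum]
  | cons u A ih =>
    simp only [List.reverse_cons, realDetSum_append, ih, realDetSum, List.sum_reverse, realDet]
    simp
    ring

/-- A word whose letters carry real multiplicities. -/
abbrev WeightedWord := List (ℝ × (ℤ × ℤ))

/-- The plane vector of a weighted letter. -/
def letterVec (p : ℝ × (ℤ × ℤ)) : ℝ × ℝ := (p.1 * p.2.1, p.1 * p.2.2)

namespace WeightedWord

/-- The total weight. -/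
def weight (L : WeightedWord) : ℝ := (L.map Prod.fst).sum

/-- The endpoint. -/
def endpoint (L : WeightedWord) : ℝ × ℝ := (L.map letterVec).sum

/-- Twice the signed area. -/
def area2 (L : WeightedWord) : ℝ := realDetSum (L.map letterVec)

/-- Letters in `V`, weights nonnegative. -/
def IsOver (V : Set (ℤ × ℤ)) (L : WeightedWord) : Prop := ∀ p ∈ L, 0 ≤ p.1 ∧ p.2 ∈ V

@[simp] theorem weight_nil : weight [] = 0 := rfl
@[simp] theorem endpoint_nil : endpoint [] = 0 := rfl
@[simp] theorem area2_nil : area2 [] = 0 := rfl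

@[simp] theorem weight_cons (p) (L : WeightedWord) : weight (p :: L) = p.1 + weight L := by
  simp [weight]

@[simp] theorem endpoint_cons (p) (L : WeightedWord) :
    endpoint (p :: L) = letterVec p + endpoint L := by
  simp [endpoint]

@[simp] theorem area2_cons (p) (L : WeightedWord) :
    area2 (p :: L) = realDet (letterVec p) (endpoint L) + area2 L := rfl

@[simp] theorem weight_append (A B : WeightedWord) : weight (A ++ B) = weight A + weight B := by
  simp [weight]

@[simp] theorem endpoint_append (A B : WeightedWord) :
    endpoint (A ++ B) = endpoint A + endpoint B := by
  simp [endpoint]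

@[simp] theorem area2_append (A B : WeightedWord) :
    area2 (A ++ B) = area2 A + area2 B + realDet (endpoint A) (endpoint B) := by
  simp [area2, endpoint, realDetSum_append]

theorem weight_reverse (A : WeightedWord) : weight A.reverse = weight A := by
  simp [weight, List.sum_reverse]

theorem endpoint_reverse (A : WeightedWord) : endpoint A.reverse = endpoint A := by
  simp [endpoint, List.sum_reverse]

theorem area2_reverse (A : WeightedWord) : area2 A.reverse = - area2 A := by
  simp [area2, realDetSum_reverse]

/-- The endpoints of A and B are opposite, so the cross determinant vanishes: the area of a closed
word does not depend on its base point. -/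
theorem area2_append_comm {A B : WeightedWord} (h : endpoint (A ++ B) = 0) :
    area2 (B ++ A) = area2 (A ++ B) := by
  rw [endpoint_append, add_eq_zero_iff_eq_neg] at h
  simp only [area2_append, h, realDet, Prod.fst_neg, Prod.snd_neg]
  ring

theorem IsOver.weight_nonneg {V : Set (ℤ × ℤ)} {L : WeightedWord} (h : IsOver V L) :
    0 ≤ weight L := by
  refine List.sum_nonneg ?_
  simp only [List.mem_map]
  rintro _ ⟨p, hp, rfl⟩
  exact (h p hp).1

/-- All weights multiplied by `t`. -/
def scale (t : ℝ) (L : WeightedWord) : WeightedWord := L.map fun p => (t * p.1, p.2)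

@[simp] theorem weight_scale (t : ℝ) (L : WeightedWord) : weight (scale t L) = t * weight L := by
  induction L with
  | nil => simp [scale]
  | cons p L ih =>
    simp only [scale, List.map_cons, weight_cons] at ih ⊢
    rw [ih]; ring

@[simp] theorem endpoint_scale (t : ℝ) (L : WeightedWord) :
    endpoint (scale t L) = t • endpoint L := by
  induction L with
  | nil => simp [scale]
  | cons p L ih =>
    simp only [scale, List.map_cons, endpoint_cons] at ih ⊢
    rw [ih]
    ext <;> simp [letterVec] <;> ring

@[simp] theorem area2_scale (t : ℝ) (L : WeightedWord) :
    area2 (scale t L) = t ^ 2 * area2 L := by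
  induction L with
  | nil => simp [scale]
  | cons p L ih =>
    have h := endpoint_scale t L
    simp only [scale, List.map_cons, area2_cons] at ih h ⊢
    rw [ih, h]
    simp [letterVec, realDet]
    ring

theorem IsOver.scale {V : Set (ℤ × ℤ)} {L : WeightedWord} (h : IsOver V L) {t : ℝ} (ht : 0 ≤ t) :
    IsOver V (scale t L) := by
  intro p hp
  obtain ⟨q, hq, rfl⟩ := List.mem_map.1 hp
  exact ⟨mul_nonneg ht (h q hq).1, (h q hq).2⟩

/-! ### Existence of a closed word of maximal area. -/

theorem exists_repeated_letter {L : WeightedWord} (h : ¬ (L.map Prod.snd).Nodup) :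
    ∃ A p B q C, L = A ++ p :: (B ++ q :: C) ∧ p.2 = q.2 := by
  induction L with
  | nil => simp at h
  | cons p L ih =>
    by_cases hp : p.2 ∈ L.map Prod.snd
    · obtain ⟨q, hq, hqp⟩ := List.mem_map.1 hp
      obtain ⟨B, C, rfl⟩ := List.append_of_mem hq
      exact ⟨[], p, B, q, C, rfl, hqp.symm⟩
    · have : ¬ (L.map Prod.snd).Nodup := fun h' => h (by simpa using ⟨by simpa using hp, h'⟩)
      obtain ⟨A, p', B, q, C, rfl, e⟩ := ih this
      exact ⟨p :: A, p', B, q, C, rfl, e⟩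

/-- Moving the second copy of v back to the first changes the area by a nonnegative multiple of
det(v, B), where B is the part in between. Moving the first copy forward changes it by a nonnegative
multiple of -det(v, B). One of the two moves does not lose area. -/
theorem exists_merge {V : Set (ℤ × ℤ)} {L : WeightedWord} (hL : IsOver V L)
    (h : ¬ (L.map Prod.snd).Nodup) :
    ∃ L' : WeightedWord, IsOver V L' ∧ L'.length < L.length ∧ weight L' = weight L ∧
      endpoint L' = endpoint L ∧ area2 L ≤ area2 L' := by
  obtain ⟨A, ⟨s, v⟩, B, ⟨t, v'⟩, C, rfl, rfl : v = v'⟩ := exists_repeated_letter h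
  have hs := hL (s, v) (by simp)
  have ht := hL (t, v) (by simp)
  have hst : 0 ≤ s + t ∧ v ∈ V := ⟨add_nonneg hs.1 ht.1, hs.2⟩
  have hA : ∀ p ∈ A, 0 ≤ p.1 ∧ p.2 ∈ V := fun p hp => hL p (by simp [hp])
  have hB : ∀ p ∈ B, 0 ≤ p.1 ∧ p.2 ∈ V := fun p hp => hL p (by simp [hp])
  have hC : ∀ p ∈ C, 0 ≤ p.1 ∧ p.2 ∈ V := fun p hp => hL p (by simp [hp])
  rcases le_total 0 (realDet (v.1, v.2) (endpoint B)) with hd | hd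
  · refine ⟨A ++ (s + t, v) :: (B ++ C), ?_, by simp, by simp; ring, ?_, ?_⟩
    · intro p hp
      simp only [List.mem_append, List.mem_cons] at hp
      rcases hp with hp | rfl | hp | hp
      exacts [hA p hp, hst, hB p hp, hC p hp]
    · ext <;> simp [letterVec] <;> ring
    · have := mul_nonneg ht.1 hd
      simp [letterVec, realDet] at this ⊢
      linarith
  · refine ⟨A ++ (B ++ (s + t, v) :: C), ?_, by simp, by simp; ring, ?_, ?_⟩
    · intro p hp
      simp only [List.mem_append, List.mem_cons] at hp
      rcases hp with hp | hp | rfl | hp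
      exacts [hA p hp, hB p hp, hst, hC p hp]
    · ext <;> simp [letterVec] <;> ring
    · have := mul_nonpos_of_nonneg_of_nonpos hs.1 hd
      simp [letterVec, realDet] at this ⊢
      linarith

/-- Bounding the number of letters by the size of V reduces the maximization to a fixed finite
dimension, where compactness applies. -/
theorem exists_short {V : Set (ℤ × ℤ)} (hV : V.Finite) (L : WeightedWord) (hL : IsOver V L) :
    ∃ L' : WeightedWord, IsOver V L' ∧ L'.length ≤ hV.toFinset.card ∧ weight L' = weight L ∧
      endpoint L' = endpoint L ∧ area2 L ≤ area2 L' := by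
  induction hn : L.length using Nat.strong_induction_on generalizing L with
  | _ n ih =>
    by_cases hd : (L.map Prod.snd).Nodup
    · refine ⟨L, hL, ?_, rfl, rfl, le_rfl⟩
      rw [← List.length_map (f := Prod.snd), ← List.toFinset_card_of_nodup hd]
      refine Finset.card_le_card fun v hv => ?_
      simp only [List.mem_toFinset, List.mem_map] at hv
      obtain ⟨p, hp, rfl⟩ := hv
      simpa using (hL p hp).2
    · obtain ⟨L₁, h1, h2, h3, h4, h5⟩ := exists_merge hL hd
      obtain ⟨L₂, k1, k2, k3, k4, k5⟩ := ih _ (hn ▸ h2) L₁ h1 rfl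
      exact ⟨L₂, k1, k2, k3.trans h3, k4.trans h4, h5.trans k5⟩

theorem weight_endpoint_area2_replicate_zero (m : ℕ) (v : ℤ × ℤ) :
    weight (List.replicate m ((0 : ℝ), v)) = 0 ∧
      endpoint (List.replicate m ((0 : ℝ), v)) = 0 ∧
      area2 (List.replicate m ((0 : ℝ), v)) = 0 := by
  induction m with
  | zero => simp
  | succ m ih =>
    obtain ⟨h1, h2, h3⟩ := ih
    simp [List.replicate_succ, h1, h2, h3, letterVec, realDet]

theorem continuous_weight_ofFn (k : ℕ) :
    Continuous fun f : Fin k → ℝ × (ℤ × ℤ) => weight (List.ofFn f) := by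
  induction k with
  | zero => simpa using continuous_const
  | succ k ih =>
    simp only [List.ofFn_succ, weight_cons]
    exact (by fun_prop : Continuous fun f : Fin (k + 1) → ℝ × (ℤ × ℤ) => (f 0).1).add
      (ih.comp (by fun_prop : Continuous fun (f : Fin (k + 1) → ℝ × (ℤ × ℤ)) (i : Fin k) =>
        f i.succ))

theorem continuous_letterVec : Continuous letterVec := by
  have h1 : Continuous fun p : ℝ × (ℤ × ℤ) => ((p.2.1 : ℤ) : ℝ) :=
    continuous_of_discreteTopology.comp (continuous_fst.comp continuous_snd)
  have h2 : Continuous fun p : ℝ × (ℤ × ℤ) => ((p.2.2 : ℤ) : ℝ) :=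
    continuous_of_discreteTopology.comp (continuous_snd.comp continuous_snd)
  exact (continuous_fst.mul h1).prodMk (continuous_fst.mul h2)

theorem continuous_endpoint_ofFn (k : ℕ) :
    Continuous fun f : Fin k → ℝ × (ℤ × ℤ) => endpoint (List.ofFn f) := by
  induction k with
  | zero => simpa using continuous_const
  | succ k ih =>
    simp only [List.ofFn_succ, endpoint_cons]
    exact (continuous_letterVec.comp (continuous_apply 0)).add
      (ih.comp (by fun_prop : Continuous fun (f : Fin (k + 1) → ℝ × (ℤ × ℤ)) (i : Fin k) =>
        f i.succ))

theorem continuous_area2_ofFn (k : ℕ) :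
    Continuous fun f : Fin k → ℝ × (ℤ × ℤ) => area2 (List.ofFn f) := by
  induction k with
  | zero => simpa using continuous_const
  | succ k ih =>
    have hs : Continuous fun (f : Fin (k + 1) → ℝ × (ℤ × ℤ)) (i : Fin k) => f i.succ := by
      fun_prop
    have h0 : Continuous fun f : Fin (k + 1) → ℝ × (ℤ × ℤ) => letterVec (f 0) :=
      continuous_letterVec.comp (continuous_apply 0)
    have h1 := (continuous_endpoint_ofFn k).comp hs
    simp only [List.ofFn_succ, area2_cons, realDet]
    exact ((h0.fst.mul h1.snd).sub (h0.snd.mul h1.fst)).add (ih.comp hs)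

theorem exists_optimal {V : Set (ℤ × ℤ)} (hV : V.Finite) {L₀ : WeightedWord}
    (h₀ : IsOver V L₀) (hc : endpoint L₀ = 0) (hw : weight L₀ = 1) :
    ∃ L : WeightedWord, IsOver V L ∧ endpoint L = 0 ∧ weight L = 1 ∧
      ∀ L' : WeightedWord, IsOver V L' → endpoint L' = 0 → area2 L' ≤ area2 L * weight L' ^ 2 := by
  obtain ⟨v₀, hv₀⟩ : V.Nonempty := by
    rcases L₀ with _ | ⟨p, L₀⟩
    · simp at hw
    · exact ⟨p.2, (h₀ p (by simp)).2⟩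
  set k := hV.toFinset.card
  -- Letters of weight zero bring every competitor to exactly k letters, so that it becomes a point
  -- of (ℝ × V)^k.
  have pad : ∀ L : WeightedWord, IsOver V L → endpoint L = 0 → weight L = 1 →
      ∃ f : Fin k → ℝ × (ℤ × ℤ), IsOver V (List.ofFn f) ∧ endpoint (List.ofFn f) = 0 ∧
        weight (List.ofFn f) = 1 ∧ area2 L ≤ area2 (List.ofFn f) := by
    intro L h1 h2 h3
    obtain ⟨L', k1, k2, k3, k4, k5⟩ := exists_short hV L h1
    obtain ⟨z1, z2, z3⟩ := weight_endpoint_area2_replicate_zero (k - L'.length) v₀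
    set M : WeightedWord := L' ++ List.replicate (k - L'.length) ((0 : ℝ), v₀) with hM
    have hlen : M.length = k := by
      simp only [hM, List.length_append, List.length_replicate]; omega
    refine ⟨fun i => M.get (i.cast hlen.symm), ?_⟩
    have hof : List.ofFn (fun i : Fin k => M.get (i.cast hlen.symm)) = M := by
      rw [← List.ofFn_congr hlen, List.ofFn_get]
    rw [hof]
    refine ⟨?_, ?_, ?_, ?_⟩
    · intro p hp
      rcases List.mem_append.1 hp with hp | hp
      · exact k1 p hp
      · rw [List.eq_of_mem_replicate hp]; exact ⟨le_rfl, hv₀⟩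
    · rw [hM, endpoint_append, k4, h2, z2, add_zero]
    · rw [hM, weight_append, k3, h3, z1, add_zero]
    · rw [hM, area2_append, z2, z3]
      simpa [realDet] using k5
  let K : Set (Fin k → ℝ × (ℤ × ℤ)) :=
    (Set.univ.pi fun _ => Set.Icc (0 : ℝ) 1 ×ˢ V) ∩
      ({f | endpoint (List.ofFn f) = 0} ∩ {f | weight (List.ofFn f) = 1})
  have hK : IsCompact K :=
    (isCompact_univ_pi fun _ => isCompact_Icc.prod hV.isCompact).inter_right
      ((isClosed_eq (continuous_endpoint_ofFn k) continuous_const).inter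
        (isClosed_eq (continuous_weight_ofFn k) continuous_const))
  have memK : ∀ f : Fin k → ℝ × (ℤ × ℤ), IsOver V (List.ofFn f) → endpoint (List.ofFn f) = 0 →
      weight (List.ofFn f) = 1 → f ∈ K := by
    intro f h1 h2 h3
    refine ⟨fun i _ => ?_, h2, h3⟩
    have h := h1 (f i) (by simp [List.mem_ofFn])
    refine ⟨⟨h.1, ?_⟩, h.2⟩
    rw [← h3, weight, List.map_ofFn, List.sum_ofFn]
    exact Finset.single_le_sum (f := fun i => (f i).1)
      (fun j _ => (h1 (f j) (by simp [List.mem_ofFn])).1) (Finset.mem_univ i)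
  obtain ⟨f₀, e1, e2, e3, -⟩ := pad L₀ h₀ hc hw
  obtain ⟨f, hf, hmax⟩ := hK.exists_isMaxOn ⟨f₀, memK f₀ e1 e2 e3⟩
    (continuous_area2_ofFn k).continuousOn
  refine ⟨List.ofFn f, ?_, hf.2.1, hf.2.2, ?_⟩
  · intro p hp
    obtain ⟨i, rfl⟩ := List.mem_ofFn.1 hp
    have := hf.1 i (Set.mem_univ i)
    exact ⟨this.1.1, this.2⟩
  · have key : ∀ L' : WeightedWord, IsOver V L' → endpoint L' = 0 → weight L' = 1 →
        area2 L' ≤ area2 (List.ofFn f) := by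
      intro L' h1 h2 h3
      obtain ⟨g, g1, g2, g3, g4⟩ := pad L' h1 h2 h3
      exact g4.trans (hmax (memK g g1 g2 g3))
    intro L' h1 h2
    -- Positive weight is normalized to one by homogeneity; weight zero forces all weights, hence
    -- the area, to vanish.
    rcases h1.weight_nonneg.eq_or_lt with h | h
    · have hz : ∀ M : WeightedWord, IsOver V M → weight M = 0 → area2 M = 0 := by
        intro M
        induction M with
        | nil => simp
        | cons p M ih =>
          intro hM hw
          have hM' : IsOver V M := fun q hq => hM q (by simp [hq])
          have a := (hM p (by simp)).1
          have b := hM'.weight_nonneg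
          rw [weight_cons] at hw
          have a0 : p.1 = 0 := by linarith
          simp [area2_cons, ih hM' (by linarith), letterVec, realDet, a0]
      rw [hz L' h1 h.symm, ← h]; simp
    · have := key (scale (weight L')⁻¹ L') (h1.scale (by positivity)) (by simp [h2])
        (by simp [h.ne'])
      rw [area2_scale] at this
      calc area2 L' = weight L' ^ 2 * ((weight L')⁻¹ ^ 2 * area2 L') := by field_simp
        _ ≤ weight L' ^ 2 * area2 (List.ofFn f) := by gcongr
        _ = _ := mul_comm _ _

theorem filter_pos {V : Set (ℤ × ℤ)} {L : WeightedWord} (h : IsOver V L) :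
    weight (L.filter fun p => 0 < p.1) = weight L ∧
      endpoint (L.filter fun p => 0 < p.1) = endpoint L ∧
      area2 (L.filter fun p => 0 < p.1) = area2 L := by
  induction L with
  | nil => simp
  | cons p L ih =>
    obtain ⟨h1, h2, h3⟩ := ih fun q hq => h q (by simp [hq])
    rcases (h p (by simp)).1.eq_or_lt with hp | hp
    · simp [← hp, h1, h2, h3, letterVec, realDet]
    · simp [hp, h1, h2, h3]

end WeightedWord

/-! ### Corners of optimal words. -/

theorem List.exists_last_not {α : Type*} (T : α → Prop) {R : List α} (h : ∃ q ∈ R, ¬ T q) :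
    ∃ A q B, R = A ++ q :: B ∧ ¬ T q ∧ ∀ p ∈ B, T p := by
  induction R with
  | nil => simp at h
  | cons r R ih =>
    by_cases hR : ∃ q ∈ R, ¬ T q
    · obtain ⟨A, q, B, rfl, h1, h2⟩ := ih hR
      exact ⟨r :: A, q, B, rfl, h1, h2⟩
    · push Not at hR
      obtain ⟨q, hq, hT⟩ := h
      rcases List.mem_cons.1 hq with rfl | hq
      · exact ⟨[], q, R, rfl, hT, hR⟩
      · exact absurd (hR q hq) hT

/-- If a property holds for some letters of a cyclic word but not for all, it switches on between
two cyclically adjacent letters. -/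
theorem List.exists_isRotated_switch {α : Type*} (T : α → Prop) {L : List α} (h : ∃ p ∈ L, T p)
    (h' : ∃ q ∈ L, ¬ T q) : ∃ p B q, L ~r (p :: (B ++ [q])) ∧ T p ∧ ¬ T q := by
  obtain ⟨p, hp, hTp⟩ := h
  obtain ⟨A, C, rfl⟩ := List.append_of_mem hp
  have h1 : (A ++ p :: C) ~r (p :: (C ++ A)) := by
    simpa using (List.isRotated_append : (A ++ p :: C) ~r (p :: C ++ A))
  obtain ⟨R₁, q, R₂, hR, hTq, hR₂⟩ := List.exists_last_not T (R := C ++ A) (by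
    obtain ⟨q, hq, hTq⟩ := h'
    refine ⟨q, ?_, hTq⟩
    simp only [List.mem_append, List.mem_cons] at hq ⊢
    rcases hq with hq | rfl | hq
    exacts [Or.inr hq, absurd hTp hTq, Or.inl hq])
  rw [hR] at h1
  rcases R₂ with _ | ⟨r, R₂⟩
  · exact ⟨p, R₁, q, h1, hTp, hTq⟩
  · refine ⟨r, R₂ ++ p :: R₁, q, h1.trans ?_, hR₂ r (by simp), hTq⟩
    simpa using (List.isRotated_append : (p :: R₁ ++ [q]) ++ (r :: R₂) ~r _)

namespace WeightedWord

theorem area2_isRotated {L M : WeightedWord} (h : L ~r M) (hc : endpoint L = 0) :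
    area2 M = area2 L := by
  obtain ⟨n, hn, rfl⟩ := List.isRotated_iff_mod.1 h
  rw [List.rotate_eq_drop_append_take hn]
  conv_rhs => rw [← List.take_append_drop n L]
  rw [area2_append_comm (by rw [List.take_append_drop, hc])]

theorem weight_perm {L M : WeightedWord} (h : L.Perm M) : weight L = weight M :=
  (h.map _).sum_eq

theorem endpoint_perm {L M : WeightedWord} (h : L.Perm M) : endpoint L = endpoint M :=
  (h.map _).sum_eq

theorem sum_realDet (w : ℝ × ℝ) (L : WeightedWord) :
    (L.map fun p => realDet w (letterVec p)).sum = realDet w (endpoint L) := by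
  induction L with
  | nil => simp [realDet]
  | cons p L ih =>
    rw [List.map_cons, List.sum_cons, ih, endpoint_cons]
    simp only [realDet, Prod.fst_add, Prod.snd_add]
    ring

theorem area2_eq_zero_of_collinear {w : ℝ × ℝ} (hw : w ≠ 0) {L : WeightedWord}
    (h : ∀ p ∈ L, realDet w (letterVec p) = 0) : area2 L = 0 := by
  induction L with
  | nil => simp
  | cons p L ih =>
    have h1 := h p (by simp)
    have hL : ∀ q ∈ L, realDet w (letterVec q) = 0 := fun q hq => h q (by simp [hq])
    have h2 : realDet w (endpoint L) = 0 := by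
      rw [← sum_realDet]
      refine List.sum_eq_zero fun x hx => ?_
      obtain ⟨q, hq, rfl⟩ := List.mem_map.1 hx
      exact hL q hq
    rw [area2_cons, ih hL, add_zero]
    simp only [realDet] at h1 h2 ⊢
    by_contra hne
    refine hw (Prod.ext ?_ ?_)
    · refine (mul_eq_zero.1 (?_ : w.1 * _ = 0)).resolve_right hne
      linear_combination (endpoint L).1 * (-h1) + (letterVec p).1 * h2
    · refine (mul_eq_zero.1 (?_ : w.2 * _ = 0)).resolve_right hne
      linear_combination (endpoint L).2 * (-h1) + (letterVec p).2 * h2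

/-- A word of maximal area among the closed words over `V`, normalized to weight one. -/
structure IsOptimal (V : Set (ℤ × ℤ)) (L : WeightedWord) : Prop where
  pos : ∀ p ∈ L, 0 < p.1
  mem : ∀ p ∈ L, p.2 ∈ V
  endpoint_eq : endpoint L = 0
  weight_eq : weight L = 1
  area2_pos : 0 < area2 L
  area2_le : ∀ L' : WeightedWord, IsOver V L' → endpoint L' = 0 →
    area2 L' ≤ area2 L * weight L' ^ 2

theorem IsOptimal.isOver {V : Set (ℤ × ℤ)} {L : WeightedWord} (h : IsOptimal V L) :
    IsOver V L := fun p hp => ⟨(h.pos p hp).le, h.mem p hp⟩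

theorem IsOptimal.of_isRotated {V : Set (ℤ × ℤ)} {L M : WeightedWord} (h : IsOptimal V L)
    (hr : L ~r M) : IsOptimal V M where
  pos p hp := h.pos p (hr.mem_iff.2 hp)
  mem p hp := h.mem p (hr.mem_iff.2 hp)
  endpoint_eq := by rw [← endpoint_perm hr.perm, h.endpoint_eq]
  weight_eq := by rw [← weight_perm hr.perm, h.weight_eq]
  area2_pos := by rw [area2_isRotated hr h.endpoint_eq]; exact h.area2_pos
  area2_le := by rw [area2_isRotated hr h.endpoint_eq]; exact h.area2_le

/-- At a corner of an optimal word that is visible from the direction `w`, the word turns left. -/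
theorem IsOptimal.turn_pos {V : Set (ℤ × ℤ)} {p q : ℝ × (ℤ × ℤ)} {B : WeightedWord}
    (h : IsOptimal V (p :: (B ++ [q]))) {w : ℝ × ℝ}
    (hp : 0 < realDet w (p.2.1, p.2.2)) (hq : realDet w (q.2.1, q.2.2) ≤ 0) :
    0 < realDet (q.2.1, q.2.2) (p.2.1, p.2.2) := by
  obtain ⟨α, v⟩ := p
  obtain ⟨β, u⟩ := q
  have hα : 0 < α := h.pos (α, v) (by simp)
  have hβ : 0 < β := h.pos (β, u) (by simp)
  have hv : v ∈ V := h.mem (α, v) (by simp)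
  have hu : u ∈ V := h.mem (β, u) (by simp)
  have hB : IsOver V B := fun p hp => h.isOver p (by simp [hp])
  have he := h.endpoint_eq
  have hw := h.weight_eq
  have h1 := congrArg Prod.fst he
  have h2 := congrArg Prod.snd he
  simp only [endpoint_cons, endpoint_append, endpoint_nil, letterVec, Prod.fst_add, Prod.snd_add,
    Prod.fst_zero, Prod.snd_zero, add_zero] at h1 h2
  simp only [weight_cons, weight_append, weight_nil, add_zero] at hw
  have hrot : area2 ((β, u) :: (α, v) :: B) = area2 ((α, v) :: (B ++ [(β, u)])) :=
    area2_isRotated (L := (α, v) :: B ++ [(β, u)]) (M := [(β, u)] ++ (α, v) :: B)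
      List.isRotated_append (by simpa using he)
  have hδ := h.area2_pos
  have hle := h.area2_le
  rw [← hrot] at hδ hle
  simp only at hp hq ⊢
  rcases lt_trichotomy 0 (realDet (u.1, u.2) (v.1, v.2)) with hd | hd | hd
  · exact hd
  -- Here u = -c v with c ≥ 0, so the word backtracks (or u = 0). Cancelling ε of u against cε of v
  -- keeps endpoint and area but lowers the weight, contradicting optimality.
  · exfalso
    set c := - realDet w (u.1, u.2) / realDet w (v.1, v.2) with hc
    have hc0 : 0 ≤ c := div_nonneg (by linarith) hp.le
    have hcu1 : (u.1 : ℝ) = - c * v.1 := by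
      rw [hc]; field_simp
      simp only [realDet] at hd ⊢
      linear_combination -w.1 * hd
    have hcu2 : (u.2 : ℝ) = - c * v.2 := by
      rw [hc]; field_simp
      simp only [realDet] at hd ⊢
      linear_combination -w.2 * hd
    set ε := min β (α / (c + 1)) with hε
    have hε0 : 0 < ε := lt_min hβ (by positivity)
    have hε1 : ε ≤ β := min_le_left _ _
    have hε2 : c * ε ≤ α := by
      have : ε ≤ α / (c + 1) := min_le_right _ _
      rw [le_div_iff₀ (by positivity)] at this
      nlinarith
    have hov : IsOver V ((β - ε, u) :: (α - c * ε, v) :: B) := by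
      intro p hp
      simp only [List.mem_cons] at hp
      rcases hp with rfl | rfl | hp
      exacts [⟨by simpa using hε1, hu⟩, ⟨by simpa using hε2, hv⟩, hB p hp]
    have key := hle _ hov (by
      ext
      · simp [letterVec, hcu1] at h1 ⊢; linear_combination h1
      · simp [letterVec, hcu2] at h2 ⊢; linear_combination h2)
    have harea : area2 ((β - ε, u) :: (α - c * ε, v) :: B) = area2 ((β, u) :: (α, v) :: B) := by
      simp [letterVec, realDet, hcu1, hcu2]; ring
    rw [harea] at key
    have hwt : weight ((β - ε, u) :: (α - c * ε, v) :: B) = 1 - ε * (1 + c) := by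
      simp; linarith
    have hw0 := hov.weight_nonneg
    rw [hwt] at key hw0
    have h0 : 0 < ε * (1 + c) := by positivity
    have := mul_pos hδ (mul_pos h0 (by linarith : 0 < 2 - ε * (1 + c)))
    linarith
  -- At a right turn, exchanging the two adjacent letters gains area at the same weight.
  · exfalso
    have hov : IsOver V ((α, v) :: (β, u) :: B) := by
      intro p hp
      simp only [List.mem_cons] at hp
      rcases hp with rfl | rfl | hp
      exacts [⟨hα.le, hv⟩, ⟨hβ.le, hu⟩, hB p hp]
    have key := hle _ hov (by
      ext
      · simp [letterVec]; linear_combination h1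
      · simp [letterVec]; linear_combination h2)
    have hwt : weight ((α, v) :: (β, u) :: B) = 1 := by simp; linarith
    rw [hwt] at key
    have := mul_pos hα hβ
    simp [letterVec, realDet] at key hd
    nlinarith

/-- Every vector lies in the cone spanned by two cyclically adjacent letters of an optimal word. -/
theorem IsOptimal.exists_corner {V : Set (ℤ × ℤ)} {L : WeightedWord} (h : IsOptimal V L)
    (w : ℝ × ℝ) : ∃ (p : ℝ × (ℤ × ℤ)) (B : WeightedWord) (q : ℝ × (ℤ × ℤ)) (a b : ℝ),
      L ~r (p :: (B ++ [q])) ∧ 0 ≤ a ∧ 0 ≤ b ∧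
      w = a • ((q.2.1 : ℝ), (q.2.2 : ℝ)) + b • ((p.2.1 : ℝ), (p.2.2 : ℝ)) ∧
      a ≤ |realDet w (p.2.1, p.2.2)| ∧ b ≤ |realDet w (q.2.1, q.2.2)| := by
  have hne : ∀ w : ℝ × ℝ, w ≠ 0 → (∃ p ∈ L, 0 < realDet w (p.2.1, p.2.2)) ∧
      ∃ p ∈ L, ¬ 0 < realDet w (p.2.1, p.2.2) := by
    intro w hw
    have hlv : ∀ p : ℝ × (ℤ × ℤ), realDet w (letterVec p) = p.1 * realDet w (p.2.1, p.2.2) := by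
      intro p; simp [letterVec, realDet]; ring
    have hsum := sum_realDet w L
    rw [h.endpoint_eq] at hsum
    have hz : realDet w 0 = 0 := by simp [realDet]
    rw [hz] at hsum
    -- The determinants of w with the weighted letters sum to zero. If none is positive, all vanish,
    -- the word is collinear and its area is zero; if all are positive, so is their sum.
    constructor
    · by_contra! hcon
      refine h.area2_pos.ne' (area2_eq_zero_of_collinear hw fun p hp => ?_)
      have hnn : ∀ x ∈ L.map fun p => - realDet w (letterVec p), 0 ≤ x := by
        intro x hx
        obtain ⟨r, hr, rfl⟩ := List.mem_map.1 hx
        rw [hlv]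
        have := mul_nonneg (h.pos r hr).le (neg_nonneg.2 (hcon r hr))
        linarith
      have h0 : (L.map fun p => - realDet w (letterVec p)).sum = 0 := by
        have := List.sum_neg (L.map fun p => realDet w (letterVec p))
        simpa [hsum, Function.comp_def] using this.symm
      have h1 := List.single_le_sum hnn _ (List.mem_map.2 ⟨p, hp, rfl⟩)
      have h2 := mul_nonpos_of_nonneg_of_nonpos (h.pos p hp).le (hcon p hp)
      rw [h0] at h1
      rw [hlv] at h1 ⊢
      linarith
    · by_contra! hcon
      have : 0 < (L.map fun p => realDet w (letterVec p)).sum := by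
        refine List.sum_pos _ ?_ ?_
        · intro x hx
          obtain ⟨r, hr, rfl⟩ := List.mem_map.1 hx
          rw [hlv]
          exact mul_pos (h.pos r hr) (hcon r hr)
        · intro hnil
          have := h.weight_eq
          rw [List.map_eq_nil_iff.1 hnil] at this
          simp at this
      linarith
  by_cases hw : w = 0
  · obtain ⟨h1, h2⟩ := hne (1, 0) (by simp)
    obtain ⟨p, B, q, hr, -, -⟩ := List.exists_isRotated_switch _ h1 h2
    exact ⟨p, B, q, 0, 0, hr, le_rfl, le_rfl, by simp [hw], abs_nonneg _, abs_nonneg _⟩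
  · obtain ⟨h1, h2⟩ := hne w hw
    obtain ⟨p, B, q, hr, hp, hq⟩ := List.exists_isRotated_switch _ h1 h2
    have hq := not_lt.1 hq
    have hd := (h.of_isRotated hr).turn_pos hp hq
    -- Integrality: a positive determinant of integer vectors is at least 1, so the Cramer
    -- coefficients are bounded by their numerators.
    have hd1 : 1 ≤ realDet ((q.2.1 : ℝ), (q.2.2 : ℝ)) (p.2.1, p.2.2) := by
      have : realDet ((q.2.1 : ℝ), (q.2.2 : ℝ)) (p.2.1, p.2.2)
          = ((q.2.1 * p.2.2 - q.2.2 * p.2.1 : ℤ) : ℝ) := by simp [realDet]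
      rw [this] at hd ⊢
      exact_mod_cast Int.cast_pos.1 hd
    refine ⟨p, B, q, realDet w (p.2.1, p.2.2) / realDet (q.2.1, q.2.2) (p.2.1, p.2.2),
      - realDet w (q.2.1, q.2.2) / realDet (q.2.1, q.2.2) (p.2.1, p.2.2), hr, by positivity,
      div_nonneg (by linarith) hd.le, ?_, ?_, ?_⟩
    · ext
      · simp only [Prod.fst_add, Prod.smul_fst, smul_eq_mul]
        rw [div_mul_eq_mul_div, div_mul_eq_mul_div, ← add_div, eq_div_iff hd.ne']
        simp only [realDet]; ring
      · simp only [Prod.snd_add, Prod.smul_snd, smul_eq_mul]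
        rw [div_mul_eq_mul_div, div_mul_eq_mul_div, ← add_div, eq_div_iff hd.ne']
        simp only [realDet]; ring
    · exact (div_le_self hp.le hd1).trans (le_abs_self _)
    · exact (div_le_self (by linarith) hd1).trans (neg_le_abs _)

/-! ### Integral words and the isoperimetric constant. -/

/-- An integral word as a weighted word. -/
def ofWord (P : List (ℤ × ℤ)) : WeightedWord := P.map fun v => (1, v)

theorem weight_ofWord (P : List (ℤ × ℤ)) : weight (ofWord P) = P.length := by
  induction P with
  | nil => simp [ofWord]
  | cons v P ih => simp only [ofWord, List.map_cons, weight_cons] at ih ⊢; simp [ih]; ring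

theorem endpoint_ofWord (P : List (ℤ × ℤ)) :
    endpoint (ofWord P) = ((P.sum.1 : ℝ), (P.sum.2 : ℝ)) := by
  induction P with
  | nil => simp [ofWord]; rfl
  | cons v P ih =>
    simp only [ofWord, List.map_cons, endpoint_cons] at ih ⊢
    simp [ih, letterVec]

theorem map_planeDet_sum (u : ℤ × ℤ) (P : List (ℤ × ℤ)) :
    (P.map (planeDet u)).sum = planeDet u P.sum := by
  induction P with
  | nil => simp [planeDet]
  | cons v P ih => simp [ih, planeDet]; ring

theorem area2_ofWord (P : List (ℤ × ℤ)) : area2 (ofWord P) = detSum P := by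
  induction P with
  | nil => simp [ofWord, detSum]
  | cons v P ih =>
    have h := endpoint_ofWord P
    simp only [ofWord, List.map_cons, area2_cons] at ih h ⊢
    rw [ih, h, detSum, map_planeDet_sum]
    simp [planeDet, realDet, letterVec]

theorem isOver_ofWord {V : Set (ℤ × ℤ)} {P : List (ℤ × ℤ)} (h : ∀ v ∈ P, v ∈ V) :
    IsOver V (ofWord P) := by
  intro p hp
  obtain ⟨v, hv, rfl⟩ := List.mem_map.1 hp
  exact ⟨zero_le_one, h v hv⟩

theorem exists_isOptimal {V : Set (ℤ × ℤ)} (hV : V.Finite) {u v : ℤ × ℤ} (hu : u ∈ V)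
    (hv : v ∈ V) (hu' : -u ∈ V) (hv' : -v ∈ V) (huv : 0 < planeDet u v) :
    ∃ L, IsOptimal V L := by
  set L₀ : WeightedWord := scale (1 / 4) (ofWord [u, v, -u, -v]) with hL₀
  have h1 : IsOver V L₀ := (isOver_ofWord (by
    intro w hw
    simp only [List.mem_cons, List.not_mem_nil, or_false] at hw
    rcases hw with rfl | rfl | rfl | rfl <;> assumption)).scale (by norm_num)
  have h2 : endpoint L₀ = 0 := by
    rw [hL₀, endpoint_scale, endpoint_ofWord]
    simp
  have h3 : weight L₀ = 1 := by
    rw [hL₀, weight_scale, weight_ofWord]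
    norm_num
  have h4 : 0 < area2 L₀ := by
    have : detSum [u, v, -u, -v] = 2 * planeDet u v := by
      simp [detSum, planeDet]; ring
    rw [hL₀, area2_scale, area2_ofWord, this]
    have : (0 : ℝ) < planeDet u v := by exact_mod_cast huv
    push_cast
    positivity
  obtain ⟨L, k1, k2, k3, k4⟩ := exists_optimal hV h1 h2 h3
  obtain ⟨f1, f2, f3⟩ := filter_pos k1
  refine ⟨L.filter fun p => 0 < p.1, ?_, ?_, ?_, ?_, ?_, ?_⟩
  · intro p hp; simpa using (List.mem_filter.1 hp).2
  · intro p hp; exact (k1 p (List.mem_filter.1 hp).1).2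
  · rw [f2, k2]
  · rw [f1, k3]
  · rw [f3]
    have := k4 L₀ h1 h2
    rw [h3] at this
    linarith
  · rw [f3]; exact k4

/-- The isoperimetric constant is at most the area of an optimal word. -/
theorem IsOptimal.isoperimetricConstant_le {V : Set (ℤ × ℤ)} {L : WeightedWord}
    (h : IsOptimal V L) : isoperimetricConstant V ≤ area2 L / 2 := by
  refine Real.sSup_le ?_ (by have := h.area2_pos; positivity)
  rintro r ⟨P, ⟨hne, hPV, hs⟩, rfl⟩
  have hl : 0 < (P.length : ℝ) := by exact_mod_cast List.length_pos_iff.mpr hne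
  have := h.area2_le (ofWord P) (isOver_ofWord hPV) (by rw [endpoint_ofWord, hs]; simp)
  rw [area2_ofWord, weight_ofWord] at this
  rw [div_le_iff₀ (by positivity), signedArea]
  linarith

end WeightedWord

/-- The isoperimetric inequality. -/
theorem detSum_le {V : Set (ℤ × ℤ)} (hV : V.Finite) {P : List (ℤ × ℤ)} (hP : ∀ v ∈ P, v ∈ V)
    (hs : P.sum = 0) : (detSum P : ℝ) ≤ 2 * isoperimetricConstant V * (P.length : ℝ) ^ 2 := by
  rcases eq_or_ne P [] with rfl | hne
  · simp [detSum]
  · have hl : 0 < (P.length : ℝ) := by exact_mod_cast List.length_pos_iff.mpr hne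
    have := le_csSup (bddAbove_isoperimetric hV) ⟨P, ⟨hne, hP, hs⟩, rfl⟩
    rw [div_le_iff₀ (by positivity), signedArea] at this
    simp only [isoperimetricConstant]
    linarith

theorem isoperimetricConstant_pos {V : Set (ℤ × ℤ)} (hV : V.Finite) {u v : ℤ × ℤ} (hu : u ∈ V)
    (hv : v ∈ V) (hu' : -u ∈ V) (hv' : -v ∈ V) (huv : 0 < planeDet u v) :
    0 < isoperimetricConstant V := by
  have h := detSum_le hV (P := [u, v, -u, -v]) (by
    intro w hw
    simp only [List.mem_cons, List.not_mem_nil, or_false] at hw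
    rcases hw with rfl | rfl | rfl | rfl <;> assumption) (by simp)
  have h2 : detSum [u, v, -u, -v] = 2 * planeDet u v := by
    simp [detSum, planeDet]; ring
  have h3 : (0 : ℝ) < planeDet u v := by exact_mod_cast huv
  rw [h2] at h
  push_cast [List.length_cons, List.length_nil] at h
  nlinarith

theorem detSum_append (A B : List (ℤ × ℤ)) :
    detSum (A ++ B) = detSum A + detSum B + planeDet A.sum B.sum := by
  induction A with
  | nil => simp [detSum, planeDet]
  | cons u A ih =>
    simp only [List.cons_append, detSum, ih, WeightedWord.map_planeDet_sum, List.sum_append,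
      List.sum_cons, planeDet, Prod.fst_add, Prod.snd_add]
    ring

theorem detSum_reverse (A : List (ℤ × ℤ)) : detSum A.reverse = - detSum A := by
  induction A with
  | nil => simp [detSum]
  | cons u A ih =>
    simp only [List.reverse_cons, detSum_append, ih, detSum, WeightedWord.map_planeDet_sum,
      List.sum_reverse, planeDet]
    simp
    ring

theorem detSum_replicate (m : ℕ) (v : ℤ × ℤ) : detSum (List.replicate m v) = 0 := by
  induction m with
  | zero => simp [detSum]
  | succ m ih => simp [List.replicate_succ, detSum, ih, planeDet]; ring_nf; simp

/-! ### Rounding the weights. -/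

namespace WeightedWord

/-- The integral word obtained by rounding the weights down. -/
noncomputable def floorWord (L : WeightedWord) : List (ℤ × ℤ) :=
  L.flatMap fun p => List.replicate ⌊p.1⌋₊ p.2

theorem mem_floorWord {V : Set (ℤ × ℤ)} {L : WeightedWord} (h : IsOver V L) :
    ∀ v ∈ floorWord L, v ∈ V := by
  intro v hv
  obtain ⟨p, hp, hv⟩ := List.mem_flatMap.1 hv
  rw [List.eq_of_mem_replicate hv]
  exact (h p hp).2

theorem length_floorWord_le {V : Set (ℤ × ℤ)} {L : WeightedWord} (h : IsOver V L) :
    ((floorWord L).length : ℝ) ≤ weight L := by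
  induction L with
  | nil => simp [floorWord]
  | cons p L ih =>
    have h1 := ih fun q hq => h q (by simp [hq])
    have h2 := Nat.floor_le (h p (by simp)).1
    simp only [floorWord, List.flatMap_cons, List.length_append, List.length_replicate,
      weight_cons] at h1 ⊢
    push_cast
    linarith

theorem abs_endpoint_le {V : Set (ℤ × ℤ)} {K : ℝ}
    (hK : ∀ v ∈ V, |(v.1 : ℝ)| ≤ K ∧ |(v.2 : ℝ)| ≤ K) {L : WeightedWord} (h : IsOver V L) :
    |(endpoint L).1| ≤ K * weight L ∧ |(endpoint L).2| ≤ K * weight L := by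
  induction L with
  | nil => simp
  | cons p L ih =>
    obtain ⟨h1, h2⟩ := ih fun q hq => h q (by simp [hq])
    obtain ⟨hp, hv⟩ := h p (by simp)
    obtain ⟨k1, k2⟩ := hK _ hv
    simp only [endpoint_cons, weight_cons, letterVec, Prod.fst_add, Prod.snd_add, mul_add]
    constructor
    · refine (abs_add_le _ _).trans (add_le_add ?_ h1)
      rw [abs_mul, abs_of_nonneg hp, mul_comm]; gcongr
    · refine (abs_add_le _ _).trans (add_le_add ?_ h2)
      rw [abs_mul, abs_of_nonneg hp, mul_comm]; gcongr

theorem abs_realDet_le {u v : ℝ × ℝ} {a b : ℝ} (h1 : |u.1| ≤ a) (h2 : |u.2| ≤ a)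
    (h3 : |v.1| ≤ b) (h4 : |v.2| ≤ b) : |realDet u v| ≤ 2 * (a * b) := by
  have ha : 0 ≤ a := (abs_nonneg _).trans h1
  calc |realDet u v| ≤ |u.1 * v.2| + |u.2 * v.1| := abs_sub _ _
    _ = |u.1| * |v.2| + |u.2| * |v.1| := by rw [abs_mul, abs_mul]
    _ ≤ a * b + a * b := by gcongr
    _ = _ := by ring

theorem floorWord_cons_sum (p : ℝ × (ℤ × ℤ)) (L : WeightedWord) :
    (floorWord (p :: L)).sum = ⌊p.1⌋₊ • p.2 + (floorWord L).sum := by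
  simp [floorWord]

theorem abs_floorWord_sum_sub_le {V : Set (ℤ × ℤ)} {K : ℝ}
    (hK : ∀ v ∈ V, |(v.1 : ℝ)| ≤ K ∧ |(v.2 : ℝ)| ≤ K) {L : WeightedWord} (h : IsOver V L) :
    |((floorWord L).sum.1 : ℝ) - (endpoint L).1| ≤ K * L.length ∧
      |((floorWord L).sum.2 : ℝ) - (endpoint L).2| ≤ K * L.length := by
  induction L with
  | nil => simp [floorWord]
  | cons p L ih =>
    obtain ⟨h1, h2⟩ := ih fun q hq => h q (by simp [hq])
    obtain ⟨hp, hv⟩ := h p (by simp)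
    obtain ⟨k1, k2⟩ := hK _ hv
    have hfl : |(⌊p.1⌋₊ : ℝ) - p.1| ≤ 1 := by
      have := Nat.floor_le hp
      have := Nat.lt_floor_add_one p.1
      rw [abs_le]; constructor <;> linarith
    rw [floorWord_cons_sum]
    simp only [endpoint_cons, letterVec, Prod.fst_add, Prod.snd_add, Prod.smul_fst, Prod.smul_snd,
      List.length_cons]
    simp only [nsmul_eq_mul]
    push_cast
    constructor
    · rw [show (⌊p.1⌋₊ * (p.2.1 : ℝ) + ((floorWord L).sum.1 : ℝ)) - (p.1 * p.2.1 + (endpoint L).1)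
        = (⌊p.1⌋₊ - p.1) * p.2.1 + (((floorWord L).sum.1 : ℝ) - (endpoint L).1) by ring]
      refine (abs_add_le _ _).trans ?_
      rw [abs_mul]
      have := mul_le_mul hfl k1 (abs_nonneg _) zero_le_one
      linarith
    · rw [show (⌊p.1⌋₊ * (p.2.2 : ℝ) + ((floorWord L).sum.2 : ℝ)) - (p.1 * p.2.2 + (endpoint L).2)
        = (⌊p.1⌋₊ - p.1) * p.2.2 + (((floorWord L).sum.2 : ℝ) - (endpoint L).2) by ring]
      refine (abs_add_le _ _).trans ?_
      rw [abs_mul]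
      have := mul_le_mul hfl k2 (abs_nonneg _) zero_le_one
      linarith

/-- Rounding one block moves the path by at most K in each coordinate, which costs area at most
linear in the total weight. The number of blocks will be fixed, so the error is linear in the
perimeter. -/
theorem abs_detSum_floorWord_sub_le {V : Set (ℤ × ℤ)} {K : ℝ}
    (hK : ∀ v ∈ V, |(v.1 : ℝ)| ≤ K ∧ |(v.2 : ℝ)| ≤ K) {L : WeightedWord} (h : IsOver V L) :
    |(detSum (floorWord L) : ℝ) - area2 L| ≤ 2 * K ^ 2 * (L.length * weight L) := by
  induction L with
  | nil => simp [floorWord, detSum]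
  | cons p L ih =>
    have hL : IsOver V L := fun q hq => h q (by simp [hq])
    obtain ⟨hp, hv⟩ := h p (by simp)
    obtain ⟨k1, k2⟩ := hK _ hv
    have hK0 : 0 ≤ K := (abs_nonneg _).trans k1
    have hfl : |p.1 - (⌊p.1⌋₊ : ℝ)| ≤ 1 := by
      have := Nat.floor_le hp
      have := Nat.lt_floor_add_one p.1
      rw [abs_le]; constructor <;> linarith
    have hfl' := Nat.floor_le hp
    obtain ⟨e1, e2⟩ := abs_endpoint_le hK hL
    obtain ⟨s1, s2⟩ := abs_floorWord_sum_sub_le hK hL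
    have d1 : |realDet ((p.1 - ⌊p.1⌋₊) * p.2.1, (p.1 - ⌊p.1⌋₊) * p.2.2) (endpoint L)|
        ≤ 2 * (K * (K * weight L)) := by
      refine abs_realDet_le ?_ ?_ e1 e2
      · simpa [abs_mul] using mul_le_mul hfl k1 (abs_nonneg _) zero_le_one
      · simpa [abs_mul] using mul_le_mul hfl k2 (abs_nonneg _) zero_le_one
    have d2 : |realDet (⌊p.1⌋₊ * p.2.1, ⌊p.1⌋₊ * p.2.2)
        (((floorWord L).sum.1 : ℝ) - (endpoint L).1, ((floorWord L).sum.2 : ℝ) - (endpoint L).2)|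
        ≤ 2 * ((p.1 * K) * (K * L.length)) := by
      refine abs_realDet_le ?_ ?_ s1 s2
      · rw [abs_mul, Nat.abs_cast]; gcongr
      · rw [abs_mul, Nat.abs_cast]; gcongr
    have hd : detSum (floorWord (p :: L))
        = planeDet (⌊p.1⌋₊ • p.2) (floorWord L).sum + detSum (floorWord L) := by
      simp only [floorWord, List.flatMap_cons, detSum_append, detSum_replicate,
        List.sum_replicate]
      ring
    have heq : (detSum (floorWord (p :: L)) : ℝ) - area2 (p :: L)
        = ((detSum (floorWord L) : ℝ) - area2 L)
          + realDet (⌊p.1⌋₊ * p.2.1, ⌊p.1⌋₊ * p.2.2)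
            (((floorWord L).sum.1 : ℝ) - (endpoint L).1,
              ((floorWord L).sum.2 : ℝ) - (endpoint L).2)
          - realDet ((p.1 - ⌊p.1⌋₊) * p.2.1, (p.1 - ⌊p.1⌋₊) * p.2.2) (endpoint L) := by
      rw [hd, area2_cons]
      simp only [planeDet, realDet, letterVec, Prod.smul_fst, Prod.smul_snd]
      simp only [nsmul_eq_mul]
      push_cast
      ring
    rw [heq]
    refine (abs_sub _ _).trans ((add_le_add_left (abs_add_le _ _) _).trans ?_)
    have h0 := ih hL
    have := mul_nonneg (sq_nonneg K) hp
    simp only [List.length_cons, weight_cons]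
    push_cast
    nlinarith

end WeightedWord

/-! ### Word norms. -/

section WordNorm

variable {G : Type*} [Group G] {S : Set G}

theorem wordNorm_prod_le {w : List G} (hw : ∀ s ∈ w, s ∈ S) : wordNorm S w.prod ≤ w.length :=
  Nat.sInf_le ⟨w, hw, rfl, rfl⟩

theorem exists_word (hsymm : ∀ s ∈ S, s⁻¹ ∈ S) (hgen : Subgroup.closure S = ⊤) (g : G) :
    ∃ w : List G, (∀ s ∈ w, s ∈ S) ∧ w.prod = g := by
  obtain ⟨w, hw, rfl⟩ := Submonoid.exists_list_of_mem_closure (s := S ∪ S⁻¹) (x := g) (by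
    rw [← Subgroup.closure_toSubmonoid, hgen]; trivial)
  refine ⟨w, fun s hs => ?_, rfl⟩
  rcases hw s hs with h | h
  · exact h
  · simpa using hsymm _ h

theorem exists_geodesic (hsymm : ∀ s ∈ S, s⁻¹ ∈ S) (hgen : Subgroup.closure S = ⊤) (g : G) :
    ∃ w : List G, (∀ s ∈ w, s ∈ S) ∧ w.prod = g ∧ w.length = wordNorm S g := by
  obtain ⟨w, h1, h2⟩ := exists_word hsymm hgen g
  exact Nat.sInf_mem (s := {n : ℕ | ∃ w : List G, (∀ s ∈ w, s ∈ S) ∧ w.prod = g ∧ w.length = n})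
    ⟨w.length, w, h1, h2, rfl⟩

theorem wordNorm_mul_le (hsymm : ∀ s ∈ S, s⁻¹ ∈ S) (hgen : Subgroup.closure S = ⊤) (g h : G) :
    wordNorm S (g * h) ≤ wordNorm S g + wordNorm S h := by
  obtain ⟨w, h1, h2, h3⟩ := exists_geodesic hsymm hgen g
  obtain ⟨v, k1, k2, k3⟩ := exists_geodesic hsymm hgen h
  rw [← h3, ← k3, ← List.length_append, ← h2, ← k2, ← List.prod_append]
  refine wordNorm_prod_le fun s hs => ?_
  rcases List.mem_append.1 hs with hs | hs
  exacts [h1 s hs, k1 s hs]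

end WordNorm

section AddWordNorm

variable {A : Type*} [AddCommGroup A] {V : Set A}

theorem addWordNorm_sum_le {w : List A} (hw : ∀ s ∈ w, s ∈ V) : addWordNorm V w.sum ≤ w.length :=
  Nat.sInf_le ⟨w, hw, rfl, rfl⟩

/-- `V` generates `A` as a monoid. -/
def Spans (V : Set A) : Prop := ∀ a : A, ∃ w : List A, (∀ s ∈ w, s ∈ V) ∧ w.sum = a

theorem Spans.exists_geodesic (hV : Spans V) (a : A) :
    ∃ w : List A, (∀ s ∈ w, s ∈ V) ∧ w.sum = a ∧ w.length = addWordNorm V a := by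
  obtain ⟨w, h1, h2⟩ := hV a
  exact Nat.sInf_mem (s := {n : ℕ | ∃ w : List A, (∀ s ∈ w, s ∈ V) ∧ w.sum = a ∧ w.length = n})
    ⟨w.length, w, h1, h2, rfl⟩

theorem Spans.addWordNorm_add_le (hV : Spans V) (a b : A) :
    addWordNorm V (a + b) ≤ addWordNorm V a + addWordNorm V b := by
  obtain ⟨w, h1, h2, h3⟩ := hV.exists_geodesic a
  obtain ⟨v, k1, k2, k3⟩ := hV.exists_geodesic b
  rw [← h3, ← k3, ← List.length_append, ← h2, ← k2, ← List.sum_append]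
  refine addWordNorm_sum_le fun s hs => ?_
  rcases List.mem_append.1 hs with hs | hs
  exacts [h1 s hs, k1 s hs]

theorem Spans.addWordNorm_neg_le (hV : Spans V) (hneg : ∀ v ∈ V, -v ∈ V) (a : A) :
    addWordNorm V (-a) ≤ addWordNorm V a := by
  obtain ⟨w, h1, h2, h3⟩ := hV.exists_geodesic a
  have h4 : (w.map Neg.neg).sum = -a := by rw [← h2, List.sum_neg]
  have := addWordNorm_sum_le (w := w.map Neg.neg) (V := V) (by
    intro s hs
    obtain ⟨v, hv, rfl⟩ := List.mem_map.1 hs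
    exact hneg v (h1 v hv))
  rwa [h4, List.length_map, h3] at this

theorem Spans.addWordNorm_nsmul_le (hV : Spans V) (n : ℕ) (a : A) :
    addWordNorm V (n • a) ≤ n * addWordNorm V a := by
  induction n with
  | zero =>
    have := addWordNorm_sum_le (w := ([] : List A)) (V := V) (by simp)
    simpa using this
  | succ n ih =>
    rw [succ_nsmul, add_mul, one_mul]
    exact (hV.addWordNorm_add_le _ _).trans (by gcongr)

theorem Spans.addWordNorm_zsmul_le (hV : Spans V) (hneg : ∀ v ∈ V, -v ∈ V) (n : ℤ) (a : A) :
    addWordNorm V (n • a) ≤ n.natAbs * addWordNorm V a := by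
  rcases Int.natAbs_eq n with h | h
  · rw [h, natCast_zsmul, Int.natAbs_natCast]; exact hV.addWordNorm_nsmul_le _ _
  · rw [h, neg_zsmul, natCast_zsmul, Int.natAbs_neg, Int.natAbs_natCast]
    exact (hV.addWordNorm_neg_le hneg _).trans (hV.addWordNorm_nsmul_le _ _)

end AddWordNorm

theorem Spans.exists_linear_bound {V : Set (ℤ × ℤ)} (hV : Spans V) (hneg : ∀ v ∈ V, -v ∈ V) :
    ∃ M : ℝ, 0 ≤ M ∧ ∀ x y : ℤ, (addWordNorm V (x, y) : ℝ) ≤ M * (|(x : ℝ)| + |(y : ℝ)|) := by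
  refine ⟨addWordNorm V (1, 0) + addWordNorm V (0, 1), by positivity, fun x y => ?_⟩
  have h1 := hV.addWordNorm_zsmul_le hneg x (1, 0)
  have h2 := hV.addWordNorm_zsmul_le hneg y (0, 1)
  have h3 := hV.addWordNorm_add_le (x • ((1, 0) : ℤ × ℤ)) (y • ((0, 1) : ℤ × ℤ))
  have h4 : x • ((1, 0) : ℤ × ℤ) + y • ((0, 1) : ℤ × ℤ) = (x, y) := by simp
  rw [h4] at h3
  have h5 : (addWordNorm V (x, y) : ℝ) ≤ x.natAbs * addWordNorm V (1, 0)
      + y.natAbs * addWordNorm V (0, 1) := by exact_mod_cast h3.trans (add_le_add h1 h2)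
  rw [Nat.cast_natAbs, Nat.cast_natAbs, Int.cast_abs, Int.cast_abs] at h5
  have k1 := mul_nonneg (abs_nonneg (x : ℝ)) (Nat.cast_nonneg (α := ℝ) (addWordNorm V (0, 1)))
  have k2 := mul_nonneg (abs_nonneg (y : ℝ)) (Nat.cast_nonneg (α := ℝ) (addWordNorm V (1, 0)))
  linarith

/-! ### Area in the Heisenberg group and central corrections. -/

namespace Heis

/-- Twice the third exponential coordinate. -/
def tau (g : Heis) : ℤ := 2 * g.z - g.x * g.y

theorem tau_mul (g h : Heis) : tau (g * h) = tau g + tau h + (g.x * h.y - g.y * h.x) := by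
  simp [tau]; ring

theorem sum_map_proj (w : List Heis) : (w.map proj).sum = proj w.prod := by
  induction w with
  | nil => rfl
  | cons s w ih => simp [ih, proj]

/-- In the coordinate `tau` the cocycle of the group is the determinant itself, so the difference is
exactly the sum of `tau` over the letters. -/
theorem abs_tau_prod_sub_le {K : ℝ} {w : List Heis} (hK : ∀ s ∈ w, |(tau s : ℝ)| ≤ K) :
    |(tau w.prod : ℝ) - detSum (w.map proj)| ≤ K * w.length := by
  induction w with
  | nil => simp [tau, detSum]
  | cons s w ih =>
    have h1 := ih fun t ht => hK t (by simp [ht])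
    have h2 := hK s (by simp)
    rw [List.prod_cons, tau_mul, List.map_cons, detSum, WeightedWord.map_planeDet_sum,
      sum_map_proj]
    simp only [planeDet, proj, List.length_cons]
    push_cast
    rw [show (tau s : ℝ) + tau w.prod + (s.x * w.prod.y - s.y * w.prod.x)
      - (s.x * w.prod.y - s.y * w.prod.x + detSum (w.map proj))
      = tau s + (tau w.prod - detSum (w.map proj)) by ring]
    refine (abs_add_le _ _).trans ?_
    linarith

theorem exists_lift {S : Set Heis} {P : List (ℤ × ℤ)} (hP : ∀ v ∈ P, v ∈ proj '' S) :
    ∃ w : List Heis, (∀ s ∈ w, s ∈ S) ∧ w.map proj = P := by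
  induction P with
  | nil => exact ⟨[], by simp, rfl⟩
  | cons v P ih =>
    obtain ⟨w, h1, rfl⟩ := ih fun u hu => hP u (by simp [hu])
    obtain ⟨s, hs, rfl⟩ := hP v (by simp)
    refine ⟨s :: w, fun t ht => ?_, rfl⟩
    rcases List.mem_cons.1 ht with rfl | ht
    exacts [hs, h1 t ht]

theorem spans_proj {S : Set Heis} (hsymm : ∀ s ∈ S, s⁻¹ ∈ S) (hgen : Subgroup.closure S = ⊤) :
    Spans (proj '' S) := by
  rintro ⟨x, y⟩
  obtain ⟨w, h1, h2⟩ := exists_word hsymm hgen (⟨x, y, 0⟩ : Heis)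
  refine ⟨w.map proj, ?_, by rw [sum_map_proj, h2]; rfl⟩
  intro v hv
  obtain ⟨s, hs, rfl⟩ := List.mem_map.1 hv
  exact ⟨s, h1 s hs, rfl⟩

theorem neg_mem_proj {S : Set Heis} (hsymm : ∀ s ∈ S, s⁻¹ ∈ S) :
    ∀ v ∈ proj '' S, -v ∈ proj '' S := by
  rintro _ ⟨s, hs, rfl⟩
  exact ⟨s⁻¹, hsymm s hs, rfl⟩

theorem finite_box (R : ℝ) :
    {g : Heis | |(g.x : ℝ)| ≤ R ∧ |(g.y : ℝ)| ≤ R ∧ |(g.z : ℝ)| ≤ R}.Finite := by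
  have hI : (Set.Icc (-⌈R⌉) ⌈R⌉).Finite := Set.finite_Icc _ _
  refine ((hI.prod (hI.prod hI)).image fun p => (⟨p.1, p.2.1, p.2.2⟩ : Heis)).subset ?_
  have key : ∀ a : ℤ, |(a : ℝ)| ≤ R → a ∈ Set.Icc (-⌈R⌉) ⌈R⌉ := by
    intro a ha
    have := abs_le.1 (show |a| ≤ ⌈R⌉ by
      have : ((|a| : ℤ) : ℝ) ≤ ⌈R⌉ := by push_cast; exact ha.trans (Int.le_ceil R)
      exact_mod_cast this)
    exact this
  rintro g ⟨h1, h2, h3⟩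
  exact ⟨(g.x, g.y, g.z), ⟨key _ h1, key _ h2, key _ h3⟩, rfl⟩

/-- Turns every correction by an element of bounded coordinates into an additive constant. -/
theorem exists_bound_on_box (f : Heis → ℕ) (R : ℝ) :
    ∃ C : ℝ, 0 ≤ C ∧ ∀ g : Heis, |(g.x : ℝ)| ≤ R → |(g.y : ℝ)| ≤ R → |(g.z : ℝ)| ≤ R →
      (f g : ℝ) ≤ C := by
  obtain ⟨C, hC⟩ := ((finite_box R).image f).bddAbove
  exact ⟨C, by positivity, fun g h1 h2 h3 => by exact_mod_cast hC ⟨g, ⟨h1, h2, h3⟩, rfl⟩⟩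

/-- A bound for the coordinates of the elements of `S`. -/
def CoordBound (S : Set Heis) (K : ℝ) : Prop :=
  ∀ s ∈ S, |(s.x : ℝ)| ≤ K ∧ |(s.y : ℝ)| ≤ K ∧ |(tau s : ℝ)| ≤ K

theorem exists_coordBound {S : Set Heis} (hfin : S.Finite) : ∃ K, 1 ≤ K ∧ CoordBound S K := by
  obtain ⟨K, hK⟩ :=
    (hfin.image fun s => max |(s.x : ℝ)| (max |(s.y : ℝ)| |(tau s : ℝ)|)).bddAbove
  refine ⟨max 1 K, le_max_left _ _, fun s hs => ?_⟩
  have h := (hK ⟨s, hs, rfl⟩).trans (le_max_right 1 K)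
  exact ⟨(le_max_left _ _).trans h, ((le_max_left _ _).trans (le_max_right _ _)).trans h,
    ((le_max_right _ _).trans (le_max_right _ _)).trans h⟩

/-- A word whose suffixes stay close to the center bounds little area. -/
theorem exists_suffix_of_tau {S : Set Heis} {K E : ℝ} (hK : CoordBound S K) {w : List Heis}
    (hw : ∀ s ∈ w, s ∈ S) (h : K * (2 * E + 1) * w.length < |(tau w.prod : ℝ)|) :
    ∃ A B, w = A ++ B ∧ (E < |(B.prod.x : ℝ)| ∨ E < |(B.prod.y : ℝ)|) := by
  induction w with
  | nil => simp [tau] at h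
  | cons s w ih =>
    by_cases hlt : K * (2 * E + 1) * w.length < |(tau w.prod : ℝ)|
    · obtain ⟨A, B, rfl, hB⟩ := ih (fun t ht => hw t (by simp [ht])) hlt
      exact ⟨s :: A, B, rfl, hB⟩
    -- If the suffix w were within E of the center, prepending s would change `tau` by at most K +
    -- 2KE, which is the increase of the bound per letter.
    · refine ⟨[s], w, rfl, ?_⟩
      by_contra! hcon
      obtain ⟨k1, k2, k3⟩ := hK s (hw s (by simp))
      have hd := WeightedWord.abs_realDet_le (u := (s.x, s.y)) (v := (w.prod.x, w.prod.y))
        k1 k2 hcon.1 hcon.2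
      rw [List.prod_cons, tau_mul, List.length_cons] at h
      push_cast at h
      have h1 := abs_add_le ((tau s : ℝ) + tau w.prod) (s.x * w.prod.y - s.y * w.prod.x)
      have h2 := abs_add_le (tau s : ℝ) (tau w.prod)
      simp only [realDet] at hd
      linarith

/-- Discrete intermediate value argument: the determinant with e is 0 on the empty suffix and
changes by at most K per letter. -/
theorem exists_suffix_near {e : Heis} {K d : ℝ} {w : List Heis}
    (hK : ∀ s ∈ w, |(e.x * s.y - e.y * s.x : ℝ)| ≤ K) (hd : 0 ≤ d) (hK0 : 0 ≤ K)
    (h : d ≤ e.x * w.prod.y - e.y * w.prod.x) :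
    ∃ A B, w = A ++ B ∧ |(e.x * B.prod.y - e.y * B.prod.x : ℝ) - d| ≤ K := by
  induction w with
  | nil =>
    simp at h
    exact ⟨[], [], rfl, by simpa [le_antisymm h hd] using hK0⟩
  | cons s w ih =>
    by_cases hlt : d ≤ e.x * w.prod.y - e.y * w.prod.x
    · obtain ⟨A, B, rfl, hB⟩ := ih (fun t ht => hK t (by simp [ht])) hlt
      exact ⟨s :: A, B, rfl, hB⟩
    · refine ⟨[], s :: w, rfl, ?_⟩
      have := hK s (by simp)
      rw [List.prod_cons, mul_x, mul_y] at h ⊢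
      push_cast at h ⊢
      rw [abs_le] at this ⊢
      constructor <;> linarith

/-- The commutator of e and B is central. This shifts z without moving the projection, by an amount
governed by the position at which e is inserted. -/
theorem prod_insert (A B e : Heis) :
    A * e * B * e⁻¹ = A * B * ⟨0, 0, e.x * B.y - e.y * B.x⟩ := by
  ext <;> simp <;> ring

theorem exists_insertion_of_le {S : Set Heis} (hsymm : ∀ s ∈ S, s⁻¹ ∈ S)
    (hgen : Subgroup.closure S = ⊤) {e : Heis} {K d : ℝ} {A B : List Heis}
    (hw : ∀ s ∈ A ++ B, s ∈ S) (hK : ∀ s ∈ S, |(e.x * s.y - e.y * s.x : ℝ)| ≤ K) (hK0 : 0 ≤ K)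
    (h : |d| ≤ e.x * B.prod.y - e.y * B.prod.x) :
    ∃ f : ℤ, |(f : ℝ) - d| ≤ K ∧ wordNorm S ((A ++ B).prod * ⟨0, 0, f⟩) ≤
      (A ++ B).length + wordNorm S e + wordNorm S e⁻¹ := by
  obtain ⟨B₁, B₂, rfl, hB⟩ := exists_suffix_near (w := B)
    (fun s hs => hK s (hw s (by simp [hs]))) (abs_nonneg d) hK0 h
  have n1 : wordNorm S (A ++ B₁).prod ≤ (A ++ B₁).length :=
    wordNorm_prod_le fun s hs => hw s (by
      simp only [List.mem_append] at hs ⊢; tauto)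
  have n2 : wordNorm S B₂.prod ≤ B₂.length := wordNorm_prod_le fun s hs => hw s (by simp [hs])
  have n3 : ∀ e : Heis, wordNorm S ((A ++ B₁).prod * e * B₂.prod * e⁻¹) ≤
      (A ++ (B₁ ++ B₂)).length + wordNorm S e + wordNorm S e⁻¹ := by
    intro e
    have m1 := wordNorm_mul_le hsymm hgen ((A ++ B₁).prod * e * B₂.prod) e⁻¹
    have m2 := wordNorm_mul_le hsymm hgen ((A ++ B₁).prod * e) B₂.prod
    have m3 := wordNorm_mul_le hsymm hgen (A ++ B₁).prod e
    simp only [List.length_append] at *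
    omega
  have hsplit : (A ++ (B₁ ++ B₂)).prod = (A ++ B₁).prod * B₂.prod := by
    rw [← List.append_assoc, List.prod_append]
  rcases le_total 0 d with hd | hd
  · rw [abs_of_nonneg hd] at hB
    refine ⟨e.x * B₂.prod.y - e.y * B₂.prod.x, by push_cast; exact hB, ?_⟩
    rw [hsplit, ← prod_insert]
    exact n3 e
  -- For negative d, inserting e⁻¹ at the same place shifts in the opposite direction.
  · rw [abs_of_nonpos hd] at hB
    refine ⟨-(e.x * B₂.prod.y - e.y * B₂.prod.x), ?_, ?_⟩
    · rw [← abs_neg]; push_cast; convert hB using 2; ring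
    · have := n3 e⁻¹
      rw [prod_insert, inv_inv] at this
      rw [hsplit]
      refine le_trans (le_of_eq ?_) (this.trans (by omega))
      congr 3
      simp; ring

/-- Inserting a commutator at a suitable place moves the endpoint of a word in the central
direction by a prescribed amount, up to a bounded error. -/
theorem exists_insertion {S : Set Heis} (hsymm : ∀ s ∈ S, s⁻¹ ∈ S)
    (hgen : Subgroup.closure S = ⊤) {e : Heis} {K d : ℝ} {A B : List Heis}
    (hw : ∀ s ∈ A ++ B, s ∈ S) (hK : ∀ s ∈ S, |(e.x * s.y - e.y * s.x : ℝ)| ≤ K) (hK0 : 0 ≤ K)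
    (h : |d| ≤ |(e.x * B.prod.y - e.y * B.prod.x : ℝ)|) :
    ∃ f : ℤ, |(f : ℝ) - d| ≤ K ∧ wordNorm S ((A ++ B).prod * ⟨0, 0, f⟩) ≤
      (A ++ B).length + wordNorm S e + wordNorm S e⁻¹ := by
  rcases le_total 0 (e.x * B.prod.y - e.y * B.prod.x : ℝ) with hs | hs
  · rw [abs_of_nonneg hs] at h
    exact exists_insertion_of_le hsymm hgen hw hK hK0 h
  · rw [abs_of_nonpos hs] at h
    obtain ⟨f, h1, h2⟩ := exists_insertion_of_le hsymm hgen (e := e⁻¹) (d := d) hw (fun s hs => by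
      have := hK s hs
      rw [← abs_neg] at this
      convert this using 2
      simp; ring) hK0 (by simp at h ⊢; linarith)
    refine ⟨f, h1, ?_⟩
    rw [inv_inv] at h2
    omega

end Heis

/-! ### Cutting a corner to reach a prescribed endpoint. -/

namespace WeightedWord

/-- Shrinking an optimal word by the factor `n` and cutting off a corner yields a nearly optimal
word that ends at a prescribed point. -/
theorem IsOptimal.exists_cut {V : Set (ℤ × ℤ)} {L : WeightedWord} (h : IsOptimal V L) {K : ℝ}
    (hK : ∀ v ∈ V, |(v.1 : ℝ)| ≤ K ∧ |(v.2 : ℝ)| ≤ K) :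
    ∃ c : ℝ, 0 < c ∧ ∀ (n : ℝ) (x y : ℤ), 0 ≤ n → K * (|(x : ℝ)| + |(y : ℝ)|) ≤ c * n →
      ∃ (R : WeightedWord) (a b : ℝ) (u v : ℤ × ℤ), IsOver V R ∧
        endpoint R = ((x : ℝ), (y : ℝ)) ∧ weight R = n - a - b ∧ R.length = L.length ∧
        |area2 R - n ^ 2 * area2 L| ≤ 2 * K ^ 2 * (a * b) ∧ u ∈ V ∧ v ∈ V ∧ 0 ≤ a ∧ 0 ≤ b ∧
        a ≤ K * (|(x : ℝ)| + |(y : ℝ)|) ∧ b ≤ K * (|(x : ℝ)| + |(y : ℝ)|) ∧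
        -(x : ℝ) = a * u.1 + b * v.1 ∧ -(y : ℝ) = a * u.2 + b * v.2 := by
  -- A positive lower bound for the weights: after scaling by n, each edge is long enough to be
  -- shortened by a or b.
  obtain ⟨c, hc, hcL⟩ : ∃ c : ℝ, 0 < c ∧ ∀ p ∈ L, c ≤ p.1 := by
    have : ∀ M : WeightedWord, (∀ p ∈ M, 0 < p.1) → ∃ c : ℝ, 0 < c ∧ ∀ p ∈ M, c ≤ p.1 := by
      intro M
      induction M with
      | nil => exact fun _ => ⟨1, one_pos, by simp⟩
      | cons p M ih =>
        intro hM
        obtain ⟨c, hc, h'⟩ := ih fun q hq => hM q (by simp [hq])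
        refine ⟨min c p.1, lt_min hc (hM p (by simp)), fun q hq => ?_⟩
        rcases List.mem_cons.1 hq with rfl | hq
        · exact min_le_right _ _
        · exact (min_le_left _ _).trans (h' q hq)
    exact this L h.pos
  refine ⟨c, hc, fun n x y hn hxy => ?_⟩
  obtain ⟨⟨α, v⟩, B, ⟨β, u⟩, a, b, hr, ha, hb, hw, hav, hbu⟩ :=
    h.exists_corner ((-(x : ℝ), -(y : ℝ)) : ℝ × ℝ)
  have h' := h.of_isRotated hr
  have hα := hcL (α, v) (hr.mem_iff.2 (by simp))
  have hβ := hcL (β, u) (hr.mem_iff.2 (by simp))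
  have hv : v ∈ V := h'.mem (α, v) (by simp)
  have hu : u ∈ V := h'.mem (β, u) (by simp)
  have hB : IsOver V B := fun p hp => h'.isOver p (by simp [hp])
  have hdet : ∀ v ∈ V, |realDet ((-(x : ℝ), -(y : ℝ)) : ℝ × ℝ) (v.1, v.2)|
      ≤ K * (|(x : ℝ)| + |(y : ℝ)|) := by
    intro v hv
    obtain ⟨k1, k2⟩ := hK v hv
    calc |realDet ((-(x : ℝ), -(y : ℝ)) : ℝ × ℝ) (v.1, v.2)|
        ≤ |-(x : ℝ) * v.2| + |-(y : ℝ) * v.1| := abs_sub _ _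
      _ = |(x : ℝ)| * |(v.2 : ℝ)| + |(y : ℝ)| * |(v.1 : ℝ)| := by
        rw [abs_mul, abs_mul, abs_neg, abs_neg]
      _ ≤ |(x : ℝ)| * K + |(y : ℝ)| * K := by gcongr
      _ = _ := by ring
  have ha' := hav.trans (hdet v hv)
  have hb' := hbu.trans (hdet u hu)
  have hw1 := congrArg Prod.fst hw
  have hw2 := congrArg Prod.snd hw
  simp only [Prod.fst_add, Prod.snd_add, Prod.smul_fst, Prod.smul_snd, smul_eq_mul] at hw1 hw2
  have hwt := h'.weight_eq
  have he := h'.endpoint_eq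
  have e1 := congrArg Prod.fst he
  have e2 := congrArg Prod.snd he
  have har := area2_isRotated hr h.endpoint_eq
  simp only [endpoint_cons, endpoint_append, endpoint_nil, letterVec, Prod.fst_add, Prod.snd_add,
    Prod.fst_zero, Prod.snd_zero, add_zero, weight_cons, weight_append, weight_nil, area2_cons,
    area2_append, area2_nil, realDet, mul_zero, sub_zero] at hwt e1 e2 har
  have hlen := hr.perm.length_eq
  refine ⟨(n * α - b, v) :: (scale n B ++ [(n * β - a, u)]), a, b, u, v, ?_, ?_, ?_, ?_, ?_, hu, hv,
    ha, hb, ha', hb', hw1, hw2⟩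
  · intro p hp
    simp only [List.mem_cons, List.mem_append, List.not_mem_nil, or_false] at hp
    rcases hp with rfl | hp | rfl
    · exact ⟨by nlinarith, hv⟩
    · exact (hB.scale hn) p hp
    · exact ⟨by nlinarith, hu⟩
  · ext
    · simp [letterVec]; linear_combination n * e1 + hw1
    · simp [letterVec]; linear_combination n * e2 + hw2
  · simp; linear_combination n * hwt
  · rw [hlen]; simp [scale]
  · have hb1 : (endpoint B).1 = - α * v.1 - β * u.1 := by linarith
    have hb2 : (endpoint B).2 = - α * v.2 - β * u.2 := by linarith
    rw [hb1, hb2] at har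
    -- With the base point at the corner, only the triangle spanned by b v and a u is lost.
    have : area2 ((n * α - b, v) :: (scale n B ++ [(n * β - a, u)])) - n ^ 2 * area2 L
        = (a * b) * realDet (v.1, v.2) (u.1, u.2) := by
      simp [letterVec, realDet, hb1, hb2]
      linear_combination n ^ 2 * har
    rw [this, abs_mul, abs_of_nonneg (mul_nonneg ha hb)]
    have hd := abs_realDet_le (u := (v.1, v.2)) (v := (u.1, u.2)) (hK v hv).1 (hK v hv).2
      (hK u hu).1 (hK u hu).2
    calc (a * b) * |realDet (v.1, v.2) (u.1, u.2)| ≤ (a * b) * (2 * (K * K)) := by gcongr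
      _ = _ := by ring

/-- Integral words with nearly optimal area and almost prescribed endpoint. -/
theorem IsOptimal.exists_word {V : Set (ℤ × ℤ)} (hV : Spans V) (hneg : ∀ v ∈ V, -v ∈ V)
    {L : WeightedWord} (h : IsOptimal V L) {K : ℝ} (hK1 : 1 ≤ K)
    (hK : ∀ v ∈ V, |(v.1 : ℝ)| ≤ K ∧ |(v.2 : ℝ)| ≤ K) {B : ℝ} (hB : 0 ≤ B) :
    ∃ N C : ℝ, 0 ≤ C ∧ ∀ (n σ : ℝ) (x y : ℤ), N ≤ n → 0 ≤ n → (x : ℝ) ^ 2 ≤ B * n →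
      (y : ℝ) ^ 2 ≤ B * n → (σ = 1 ∨ σ = -1) →
      ∃ P : List (ℤ × ℤ), (∀ v ∈ P, v ∈ V) ∧ (P.length : ℝ) ≤ n - addWordNorm V (x, y) + C ∧
        |(P.sum.1 : ℝ) - x| ≤ C ∧ |(P.sum.2 : ℝ) - y| ≤ C ∧
        |(detSum P : ℝ) - σ * (n ^ 2 * area2 L)| ≤ C * n := by
  obtain ⟨c, hc, hcut⟩ := h.exists_cut hK
  obtain ⟨M, hM0, hM⟩ := hV.exists_linear_bound hneg
  -- This threshold makes √(Bn) ≤ cn/(2K), so that the cut fits. The constant adds the norm of the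
  -- rounding remainder, the endpoint error, and the area errors of cut and rounding.
  refine ⟨4 * K ^ 2 * B / c ^ 2,
    4 * M * K + K * L.length + (8 * K ^ 4 * B + 2 * K ^ 2 * L.length), by positivity, ?_⟩
  intro n σ x y hN hn hx hy hσ
  have hsmall : ∀ t : ℝ, t ^ 2 ≤ B * n → |t| ≤ c * n / (2 * K) := by
    intro t ht
    refine abs_le_of_sq_le_sq (ht.trans ?_) (by positivity)
    rw [div_le_iff₀ (by positivity)] at hN
    rw [div_pow, le_div_iff₀ (by positivity)]
    nlinarith
  have hxy : K * (|(x : ℝ)| + |(y : ℝ)|) ≤ c * n := by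
    have := add_le_add (hsmall _ hx) (hsmall _ hy)
    calc K * (|(x : ℝ)| + |(y : ℝ)|) ≤ K * (c * n / (2 * K) + c * n / (2 * K)) := by gcongr
      _ = c * n := by field_simp; ring
  obtain ⟨R, a, b, u, v, hR, hend, hwt, hlen, harea, hu, hv, ha, hb, ha', hb', h1, h2⟩ :=
    hcut n x y hn hxy
  have hab : a * b ≤ 4 * K ^ 2 * B * n := by
    calc a * b ≤ (K * (|(x : ℝ)| + |(y : ℝ)|)) * (K * (|(x : ℝ)| + |(y : ℝ)|)) := by gcongr
      _ = K ^ 2 * (|(x : ℝ)| + |(y : ℝ)|) ^ 2 := by ring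
      _ ≤ K ^ 2 * (4 * B * n) := by
        gcongr
        have := add_sq_le (a := |(x : ℝ)|) (b := |(y : ℝ)|)
        rw [sq_abs, sq_abs] at this
        linarith
      _ = _ := by ring
  -- The weight saved by the cut is at least the norm of (x,y), up to a constant: round a and b down
  -- and bound the remainder r linearly.
  have hnorm : (addWordNorm V (x, y) : ℝ) ≤ a + b + 4 * M * K := by
    set r : ℤ × ℤ := -(x, y) - (⌊a⌋₊ • u + ⌊b⌋₊ • v) with hr
    have n1 := hV.addWordNorm_neg_le hneg (-(x, y))
    have n2 := hV.addWordNorm_add_le (⌊a⌋₊ • u + ⌊b⌋₊ • v) r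
    have n3 := hV.addWordNorm_add_le (⌊a⌋₊ • u) (⌊b⌋₊ • v)
    have one : ∀ v ∈ V, addWordNorm V v ≤ 1 := fun v hv => by
      simpa using addWordNorm_sum_le (w := [v]) (V := V) (by simpa using hv)
    have n4 : addWordNorm V (⌊a⌋₊ • u) ≤ ⌊a⌋₊ :=
      (hV.addWordNorm_nsmul_le _ _).trans (by simpa using Nat.mul_le_mul_left ⌊a⌋₊ (one u hu))
    have n5 : addWordNorm V (⌊b⌋₊ • v) ≤ ⌊b⌋₊ :=
      (hV.addWordNorm_nsmul_le _ _).trans (by simpa using Nat.mul_le_mul_left ⌊b⌋₊ (one v hv))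
    rw [hr, add_sub_cancel, ← hr] at n2
    rw [neg_neg] at n1
    have n6 : (addWordNorm V (x, y) : ℝ) ≤ ⌊a⌋₊ + ⌊b⌋₊ + addWordNorm V r := by
      have : addWordNorm V (x, y) ≤ ⌊a⌋₊ + ⌊b⌋₊ + addWordNorm V r := by omega
      exact_mod_cast this
    have hfa := Nat.floor_le ha
    have hfb := Nat.floor_le hb
    have hfa' : |a - ⌊a⌋₊| ≤ 1 := by
      have := Nat.lt_floor_add_one a
      rw [abs_le]; constructor <;> linarith
    have hfb' : |b - ⌊b⌋₊| ≤ 1 := by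
      have := Nat.lt_floor_add_one b
      rw [abs_le]; constructor <;> linarith
    have hlin : ∀ s t : ℝ, |s| ≤ K → |t| ≤ K →
        |(a - ⌊a⌋₊) * s + (b - ⌊b⌋₊) * t| ≤ 2 * K := by
      intro s t hs ht
      refine (abs_add_le _ _).trans ?_
      rw [abs_mul, abs_mul]
      have i1 := mul_le_mul hfa' hs (abs_nonneg _) zero_le_one
      have i2 := mul_le_mul hfb' ht (abs_nonneg _) zero_le_one
      linarith
    have r1 : |(r.1 : ℝ)| ≤ 2 * K := by
      have e : (r.1 : ℝ) = (a - ⌊a⌋₊) * u.1 + (b - ⌊b⌋₊) * v.1 := by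
        simp [hr]; linear_combination h1
      rw [e]; exact hlin _ _ (hK u hu).1 (hK v hv).1
    have r2 : |(r.2 : ℝ)| ≤ 2 * K := by
      have e : (r.2 : ℝ) = (a - ⌊a⌋₊) * u.2 + (b - ⌊b⌋₊) * v.2 := by
        simp [hr]; linear_combination h2
      rw [e]; exact hlin _ _ (hK u hu).2 (hK v hv).2
    have n7 := (hM r.1 r.2).trans (mul_le_mul_of_nonneg_left (add_le_add r1 r2) hM0)
    rw [Prod.mk.eta] at n7
    linarith
  -- Reversal changes the sign of the area and keeps endpoint and weight, which serves negative z.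
  obtain ⟨R', hR', hend', hwt', hlen', harea'⟩ : ∃ R' : WeightedWord, IsOver V R' ∧
      endpoint R' = ((x : ℝ), (y : ℝ)) ∧ weight R' = n - a - b ∧ R'.length = L.length ∧
      |area2 R' - σ * (n ^ 2 * area2 L)| ≤ 2 * K ^ 2 * (a * b) := by
    rcases hσ with rfl | rfl
    · exact ⟨R, hR, hend, hwt, hlen, by simpa using harea⟩
    · refine ⟨R.reverse, fun p hp => hR p (List.mem_reverse.1 hp), (endpoint_reverse R).trans hend,
        (weight_reverse R).trans hwt, by simpa using hlen, ?_⟩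
      rw [area2_reverse, ← abs_neg]
      convert harea using 2
      ring
  obtain ⟨s1, s2⟩ := abs_floorWord_sum_sub_le hK hR'
  have hds := abs_detSum_floorWord_sub_le hK hR'
  have hl := length_floorWord_le hR'
  rw [hend', hlen'] at s1 s2
  rw [hlen', hwt'] at hds
  rw [hwt'] at hl
  have p1 : 0 ≤ 4 * M * K := by positivity
  have p2 : 0 ≤ K * L.length := by positivity
  have p3 : 0 ≤ 8 * K ^ 4 * B + 2 * K ^ 2 * L.length := by positivity
  refine ⟨floorWord R', mem_floorWord hR', by linarith, s1.trans (by linarith),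
    s2.trans (by linarith), ?_⟩
  have t := abs_add_le ((detSum (floorWord R') : ℝ) - area2 R')
    (area2 R' - σ * (n ^ 2 * area2 L))
  rw [sub_add_sub_cancel] at t
  have q1 : 2 * K ^ 2 * (a * b) ≤ 8 * K ^ 4 * B * n := by
    calc 2 * K ^ 2 * (a * b) ≤ 2 * K ^ 2 * (4 * K ^ 2 * B * n) := by gcongr
      _ = _ := by ring
  have q2 : 2 * K ^ 2 * (L.length * (n - a - b)) ≤ 2 * K ^ 2 * L.length * n := by
    calc 2 * K ^ 2 * (L.length * (n - a - b)) ≤ 2 * K ^ 2 * (L.length * n) := by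
          gcongr; linarith
      _ = _ := by ring
  have q3 := mul_nonneg p1 hn
  have q4 := mul_nonneg p2 hn
  linarith

end WeightedWord

/-- By symmetry of V, otherwise all determinants of letters vanish, and by bilinearity all
determinants on ℤ². -/
theorem Spans.exists_planeDet_pos {V : Set (ℤ × ℤ)} (hV : Spans V) (hneg : ∀ v ∈ V, -v ∈ V) :
    ∃ u ∈ V, ∃ v ∈ V, 0 < planeDet u v := by
  by_contra! hcon
  have h0 : ∀ u ∈ V, ∀ v ∈ V, planeDet u v = 0 := by
    intro u hu v hv
    have h1 := hcon u hu v hv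
    have h2 := hcon u hu (-v) (hneg v hv)
    simp only [planeDet, Prod.fst_neg, Prod.snd_neg] at h1 h2 ⊢
    linarith
  have h1 : ∀ u ∈ V, ∀ t, planeDet u t = 0 := by
    intro u hu t
    obtain ⟨w, hw, rfl⟩ := hV t
    rw [← WeightedWord.map_planeDet_sum]
    refine List.sum_eq_zero fun x hx => ?_
    obtain ⟨v, hv, rfl⟩ := List.mem_map.1 hx
    exact h0 u hu v (hw v hv)
  have h2 : ∀ s t, planeDet s t = 0 := by
    intro s t
    obtain ⟨w, hw, rfl⟩ := hV s
    have : planeDet t w.sum = 0 := by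
      rw [← WeightedWord.map_planeDet_sum]
      refine List.sum_eq_zero fun x hx => ?_
      obtain ⟨v, hv, rfl⟩ := List.mem_map.1 hx
      have := h1 v (hw v hv) t
      simp only [planeDet] at this ⊢
      linarith
    simp only [planeDet] at this ⊢
    linarith
  have := h2 (1, 0) (0, 1)
  simp [planeDet] at this

/-! ### The upper bound. -/

namespace Heis

theorem CoordBound.proj {S : Set Heis} {K : ℝ} (h : CoordBound S K) :
    ∀ v ∈ proj '' S, |(v.1 : ℝ)| ≤ K ∧ |(v.2 : ℝ)| ≤ K := by
  rintro _ ⟨s, hs, rfl⟩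
  exact ⟨(h s hs).1, (h s hs).2.1⟩

/-- All of s, t, x, y are of order √n, so the quadratic terms are of order n. -/
theorem abs_central_defect_le {B C D n x y s t ε d : ℝ} (hn : 1 ≤ n) (hx : x ^ 2 ≤ B * n)
    (hy : y ^ 2 ≤ B * n) (hs : |s - x| ≤ C) (ht : |t - y| ≤ C) (hε : |ε| ≤ D * n)
    (hd : 2 * d = -ε - s * t - 2 * s * (y - t)) : |d| ≤ (D + 4 * B + 5 * C ^ 2) * n := by
  have hC : C ^ 2 ≤ C ^ 2 * n := le_mul_of_one_le_right (by positivity) hn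
  have hs2 : (s - x) ^ 2 ≤ C ^ 2 := sq_le_sq' (by linarith [neg_le_of_abs_le hs])
    (le_of_abs_le hs)
  have ht2 : (t - y) ^ 2 ≤ C ^ 2 := sq_le_sq' (by linarith [neg_le_of_abs_le ht])
    (le_of_abs_le ht)
  have q1 : s ^ 2 ≤ 2 * (B + C ^ 2) * n := by linarith [sq_nonneg (s - 2 * x)]
  have q2 : t ^ 2 ≤ 2 * (B + C ^ 2) * n := by linarith [sq_nonneg (t - 2 * y)]
  obtain ⟨e1, e2⟩ := abs_le.1 hε
  have s1 := sq_nonneg (s - t)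
  have s2 := sq_nonneg (s + t)
  have s3 := sq_nonneg (s - (y - t))
  have s4 := sq_nonneg (s + (y - t))
  have s5 : 0 ≤ D * n := (abs_nonneg _).trans hε
  have s6 : 0 ≤ C ^ 2 * n := (sq_nonneg C).trans hC
  have s7 : 0 ≤ B * n := (sq_nonneg x).trans hx
  rw [abs_le]
  constructor <;> linarith

theorem exists_upper_bound {S : Set Heis} (hsymm : ∀ s ∈ S, s⁻¹ ∈ S)
    (hgen : Subgroup.closure S = ⊤) {K : ℝ} (hK1 : 1 ≤ K) (hK : CoordBound S K)
    {L : WeightedWord} (h : WeightedWord.IsOptimal (proj '' S) L) {B : ℝ} (hB : 0 ≤ B) :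
    ∃ N C : ℝ, ∀ (n σ : ℝ) (x y z : ℤ), N ≤ n → 0 ≤ n → (x : ℝ) ^ 2 ≤ B * n →
      (y : ℝ) ^ 2 ≤ B * n → (σ = 1 ∨ σ = -1) → 2 * (z : ℝ) = σ * (n ^ 2 * L.area2) →
      (wordNorm S ⟨x, y, z⟩ : ℝ) ≤ n - addWordNorm (proj '' S) (x, y) + C := by
  obtain ⟨N₁, C₁, hC₁, hword⟩ :=
    h.exists_word (spans_proj hsymm hgen) (neg_mem_proj hsymm) hK1 hK.proj hB
  set δ := L.area2
  have hδ : 0 < δ := h.area2_pos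
  set C₂ := C₁ + 2 * K with hC₂
  set C₃ := C₂ + 4 * B + 5 * C₁ ^ 2 with hC₃
  -- Chosen so that words of length 2n whose suffixes stay within cn reach only δn²/2 + O(n) in
  -- `tau`, less than the δn² - O(n) available.
  set c := δ / (8 * K) with hc
  have hc0 : 0 < c := by positivity
  -- A bounded element of size j, paired with a suffix at distance more than cn, shifts the center
  -- by at least C₃ n, enough for the defect d.
  obtain ⟨j, hj⟩ := exists_nat_ge (C₃ / c)
  rw [div_le_iff₀ hc0] at hj
  obtain ⟨C₄, hC₄0, hC₄⟩ := exists_bound_on_box (wordNorm S) (max C₁ (j * K))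
  obtain ⟨C₅, hC₅0, hC₅⟩ := exists_bound_on_box (wordNorm S) j
  refine ⟨max (max N₁ C₁) (max 1 ((4 * K + 2 * C₂) / δ + 1)), C₁ + C₄ + 2 * C₅, ?_⟩
  intro n σ x y z hN hn hx hy hσ hz
  simp only [max_le_iff] at hN
  obtain ⟨⟨hN1, hN2⟩, hN3, hN4⟩ := hN
  obtain ⟨P, hPV, hPl, hP1, hP2, hPd⟩ := hword n σ x y hN1 hn hx hy hσ
  obtain ⟨w, hw, rfl⟩ := exists_lift hPV
  rw [sum_map_proj] at hP1 hP2
  rw [List.length_map] at hPl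
  set g := w.prod with hg
  have hlen : (w.length : ℝ) ≤ 2 * n := by
    have : (0 : ℝ) ≤ addWordNorm (proj '' S) (x, y) := by positivity
    linarith
  have htau : |(tau g : ℝ) - σ * (n ^ 2 * δ)| ≤ C₂ * n := by
    have h1 := abs_tau_prod_sub_le (K := K) (w := w) fun s hs => (hK s (hw s hs)).2.2
    have h2 := abs_sub_le (tau g : ℝ) (detSum (w.map Heis.proj)) (σ * (n ^ 2 * δ))
    have h3 : K * w.length ≤ K * (2 * n) := by gcongr
    rw [hC₂, add_mul]
    linarith
  simp only [Heis.proj] at hP1 hP2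
  obtain ⟨A, T, hAT, hT⟩ := exists_suffix_of_tau (E := c * n) hK hw (by
    have h1 : |σ * (n ^ 2 * δ)| = n ^ 2 * δ := by
      rcases hσ with rfl | rfl
      · rw [one_mul, abs_of_nonneg (by positivity)]
      · rw [neg_one_mul, abs_neg, abs_of_nonneg (by positivity)]
    have h2 := abs_sub_abs_le_abs_sub (σ * (n ^ 2 * δ)) (tau g : ℝ)
    rw [abs_sub_comm, h1] at h2
    have h3 : K * (2 * (c * n) + 1) * w.length ≤ K * (2 * (c * n) + 1) * (2 * n) := by gcongr
    have h4 : K * (2 * (c * n) + 1) * (2 * n) = δ * n * n / 2 + 2 * K * n := by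
      rw [hc]; field_simp; ring
    have h5 : (4 * K + 2 * C₂) < δ * n := by
      have : (4 * K + 2 * C₂) / δ < n := by linarith
      rwa [div_lt_iff₀ hδ, mul_comm n] at this
    have h6 := mul_lt_mul_of_pos_right h5 (by linarith : 0 < n)
    nlinarith)
  -- The central coordinate of g⁻¹(x,y,z).
  set d : ℤ := z - g.z - g.x * (y - g.y) with hd
  have hdC : |(d : ℝ)| ≤ C₃ * n := by
    have e : 2 * (d : ℝ) = -((tau g : ℝ) - σ * (n ^ 2 * δ)) - g.x * g.y - 2 * g.x * (y - g.y) := by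
      rw [hd]; simp only [tau]; push_cast; linear_combination hz
    exact abs_central_defect_le hN3 hx hy hP1 hP2 htau e
  obtain ⟨e, he, hex, hey, hez⟩ : ∃ e : Heis,
      |(d : ℝ)| ≤ |(e.x * T.prod.y - e.y * T.prod.x : ℝ)| ∧ |(e.x : ℝ)| + |(e.y : ℝ)| ≤ j ∧
        e.x * e.y = 0 ∧ e.z = 0 := by
    have hbig : ∀ t : ℝ, c * n < |t| → |(d : ℝ)| ≤ j * |t| := by
      intro t ht
      calc |(d : ℝ)| ≤ C₃ * n := hdC
        _ ≤ (j * c) * n := by gcongr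
        _ = j * (c * n) := by ring
        _ ≤ j * |t| := by gcongr
    rcases hT with hT | hT
    · refine ⟨⟨0, j, 0⟩, ?_, by simp, by simp, rfl⟩
      simpa [abs_mul] using hbig _ hT
    · refine ⟨⟨j, 0, 0⟩, ?_, by simp, by simp, rfl⟩
      simpa [abs_mul] using hbig _ hT
  have hex1 : |(e.x : ℝ)| ≤ j := by linarith [abs_nonneg (e.y : ℝ)]
  have hex2 : |(e.y : ℝ)| ≤ j := by linarith [abs_nonneg (e.x : ℝ)]
  have hins := exists_insertion hsymm hgen (e := e) (K := j * K) (d := d) (A := A) (B := T)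
    (by rw [← hAT]; exact hw) (fun s hs => by
      obtain ⟨k1, k2, -⟩ := hK s hs
      calc |(e.x * s.y - e.y * s.x : ℝ)| ≤ |(e.x * s.y : ℝ)| + |(e.y * s.x : ℝ)| := abs_sub _ _
        _ = |(e.x : ℝ)| * |(s.y : ℝ)| + |(e.y : ℝ)| * |(s.x : ℝ)| := by rw [abs_mul, abs_mul]
        _ ≤ |(e.x : ℝ)| * K + |(e.y : ℝ)| * K := by gcongr
        _ = (|(e.x : ℝ)| + |(e.y : ℝ)|) * K := by ring
        _ ≤ j * K := by gcongr) (by positivity) he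
  rw [← hAT, ← hg] at hins
  obtain ⟨f, hf, hfn⟩ := hins
  have hfac : (⟨x, y, z⟩ : Heis) = g * ⟨0, 0, f⟩ * ⟨x - g.x, y - g.y, d - f⟩ := by
    ext <;> simp [hd]
    ring
  have b1 := hC₅ e hex1 hex2 (by simp [hez])
  have b2 := hC₅ e⁻¹ (by simpa using hex1) (by simpa using hex2) (by simp [hez, hey])
  have b3 := hC₄ ⟨x - g.x, y - g.y, d - f⟩
    (by push_cast; rw [abs_sub_comm]; exact hP1.trans (le_max_left _ _))
    (by push_cast; rw [abs_sub_comm]; exact hP2.trans (le_max_left _ _))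
    (by push_cast; rw [abs_sub_comm]; exact hf.trans (le_max_right _ _))
  have b4 := wordNorm_mul_le hsymm hgen (g * ⟨0, 0, f⟩) ⟨x - g.x, y - g.y, d - f⟩
  rw [← hfac] at b4
  have b5 : (wordNorm S ⟨x, y, z⟩ : ℝ) ≤ w.length + wordNorm S e + wordNorm S e⁻¹
      + wordNorm S ⟨x - g.x, y - g.y, d - f⟩ := by
    exact_mod_cast b4.trans (Nat.add_le_add_right hfn _)
  linarith

end Heis

/-! ### The lower bound. -/

theorem abs_detSum_le {V : Set (ℤ × ℤ)} {K : ℝ}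
    (hK : ∀ v ∈ V, |(v.1 : ℝ)| ≤ K ∧ |(v.2 : ℝ)| ≤ K) {P : List (ℤ × ℤ)} (hP : ∀ v ∈ P, v ∈ V) :
    |(detSum P : ℝ)| ≤ 2 * K ^ 2 * (P.length : ℝ) ^ 2 := by
  induction P with
  | nil => simp [detSum]
  | cons u P ih =>
    have hP' : ∀ v ∈ P, v ∈ V := fun v hv => hP v (by simp [hv])
    obtain ⟨k1, k2⟩ := hK u (hP u (by simp))
    obtain ⟨e1, e2⟩ := WeightedWord.abs_endpoint_le hK (WeightedWord.isOver_ofWord hP')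
    rw [WeightedWord.endpoint_ofWord, WeightedWord.weight_ofWord] at e1 e2
    have hd := WeightedWord.abs_realDet_le (u := (u.1, u.2)) k1 k2 e1 e2
    have h1 := ih hP'
    rw [detSum, WeightedWord.map_planeDet_sum, List.length_cons]
    simp only [planeDet, realDet] at hd ⊢
    push_cast
    refine (abs_add_le _ _).trans ?_
    have := sq_nonneg K
    have := mul_nonneg this (Nat.cast_nonneg (α := ℝ) P.length)
    linarith

/-- Terms linear in N and s under the square become additive constants after taking roots. -/
theorem le_add_of_sq_le {s q N a b : ℝ} (hq : 0 < q) (hN : 0 ≤ N) (ha : 0 ≤ a) (hb : 0 ≤ b)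
    (h : s ^ 2 ≤ (q * N) ^ 2 + a * N + b * s) : s ≤ q * N + b + a / q := by
  by_contra! hlt
  have h0 : 0 ≤ a / q := by positivity
  have h1 : 0 ≤ q * N := by positivity
  have h2 : q * N + a / q < s - b := by linarith
  have h3 : (q * N + a / q) * (q * N + a / q) < s * (s - b) :=
    mul_lt_mul'' (by linarith) h2 (by positivity) (by positivity)
  have h4 : (q * N) * (a / q) = a * N := by field_simp
  have h5 : 0 ≤ a * N := by positivity
  nlinarith [sq_nonneg (a / q)]

theorem sq_le_of_pow_four_le {x t r : ℝ} (hr : 0 ≤ r) (h : x ^ 4 ≤ t) (ht : t = r ^ 2) :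
    x ^ 2 ≤ r := by
  refine (le_abs_self _).trans (abs_le_of_sq_le_sq ?_ hr)
  rw [← ht]
  calc (x ^ 2) ^ 2 = x ^ 4 := by ring
    _ ≤ t := h

namespace Heis

theorem exists_lower_bound {S : Set Heis} (hfin : S.Finite) (hsymm : ∀ s ∈ S, s⁻¹ ∈ S)
    (hgen : Subgroup.closure S = ⊤) {K : ℝ} (hK1 : 1 ≤ K) (hK : CoordBound S K)
    (hγ : 0 < isoperimetricConstant (proj '' S)) :
    ∃ C : ℝ, ∀ x y z : ℤ, (x : ℝ) ^ 4 ≤ |(z : ℝ)| → (y : ℝ) ^ 4 ≤ |(z : ℝ)| →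
      Real.sqrt (|(z : ℝ)| / isoperimetricConstant (proj '' S)) ≤
        wordNorm S ⟨x, y, z⟩ + addWordNorm (proj '' S) (x, y) + C := by
  have hV := spans_proj hsymm hgen
  have hneg := neg_mem_proj hsymm
  obtain ⟨M, hM0, hM⟩ := hV.exists_linear_bound hneg
  set γ := isoperimetricConstant (proj '' S)
  set q := Real.sqrt γ with hq
  have hq0 : 0 < q := Real.sqrt_pos.2 hγ
  have hqγ : q ^ 2 = γ := Real.sq_sqrt hγ.le
  -- The term 8K²M² comes from the area of the return path, the 1 from xy, and K/2 from the `tau`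
  -- values of the letters.
  refine ⟨((8 * K ^ 2 * M ^ 2 + 1) / 2 + K / 2 / q) / q, fun x y z hx hy => ?_⟩
  set s := Real.sqrt |(z : ℝ)| with hs
  have hs0 : 0 ≤ s := Real.sqrt_nonneg _
  have hsz : |(z : ℝ)| = s ^ 2 := (Real.sq_sqrt (abs_nonneg _)).symm
  have hx2 := sq_le_of_pow_four_le hs0 hx hsz
  have hy2 := sq_le_of_pow_four_le hs0 hy hsz
  obtain ⟨w, hw, hwg, hwn⟩ := exists_geodesic hsymm hgen (⟨x, y, z⟩ : Heis)
  obtain ⟨r, hr, hrs, hrn⟩ := hV.exists_geodesic (x, y)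
  rw [← hwn, ← hrn]
  set P := w.map proj ++ r.map Neg.neg with hP
  have hrV : ∀ v ∈ r.map Neg.neg, v ∈ proj '' S := by
    intro v hv
    obtain ⟨u, hu, rfl⟩ := List.mem_map.1 hv
    exact hneg u (hr u hu)
  have hrsum : (r.map Neg.neg).sum = -(x, y) := by rw [← hrs, List.sum_neg]
  have hwsum : (w.map proj).sum = (x, y) := by rw [sum_map_proj, hwg]; rfl
  have hPV : ∀ v ∈ P, v ∈ proj '' S := by
    intro v hv
    rcases List.mem_append.1 hv with hv | hv
    · obtain ⟨u, hu, rfl⟩ := List.mem_map.1 hv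
      exact ⟨u, hw u hu, rfl⟩
    · exact hrV v hv
  have hPs : P.sum = 0 := by rw [hP, List.sum_append, hwsum, hrsum, add_neg_cancel]
  have hPl : (P.length : ℝ) = w.length + r.length := by simp [hP]
  have i1 := detSum_le (hfin.image proj) hPV hPs
  -- The reversed polygon bounds the area from below, giving |z| rather than z.
  have i2 := detSum_le (hfin.image proj) (P := P.reverse)
    (fun v hv => hPV v (List.mem_reverse.1 hv)) (by rw [List.sum_reverse, hPs])
  rw [detSum_reverse, List.length_reverse] at i2
  rw [hPl] at i1 i2
  -- There is no cross term, since the two pieces have opposite endpoints.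
  have hdP : detSum P = detSum (w.map proj) + detSum (r.map Neg.neg) := by
    rw [hP, detSum_append, hwsum, hrsum]
    simp [planeDet]; ring
  rw [hdP] at i1 i2
  push_cast at i1 i2
  have i3 := abs_tau_prod_sub_le (K := K) (w := w) fun t ht => (hK t (hw t ht)).2.2
  have i4 := abs_detSum_le hK.proj hrV
  rw [List.length_map] at i4
  have hm := hM x y
  rw [← hrn] at hm
  have hm2 : (r.length : ℝ) ^ 2 ≤ 4 * M ^ 2 * s := by
    calc (r.length : ℝ) ^ 2 ≤ (M * (|(x : ℝ)| + |(y : ℝ)|)) ^ 2 := by gcongr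
      _ = M ^ 2 * (|(x : ℝ)| + |(y : ℝ)|) ^ 2 := by ring
      _ ≤ M ^ 2 * (4 * s) := by
        gcongr
        have := add_sq_le (a := |(x : ℝ)|) (b := |(y : ℝ)|)
        rw [sq_abs, sq_abs] at this
        linarith
      _ = _ := by ring
  have i5 : 2 * K ^ 2 * (r.length : ℝ) ^ 2 ≤ 8 * K ^ 2 * M ^ 2 * s := by
    calc 2 * K ^ 2 * (r.length : ℝ) ^ 2 ≤ 2 * K ^ 2 * (4 * M ^ 2 * s) := by gcongr
      _ = _ := by ring
  have hKr : 0 ≤ K * r.length := by positivity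
  have htau : (tau w.prod : ℝ) = 2 * z - x * y := by rw [hwg]; simp [tau]
  rw [htau] at i3
  obtain ⟨a1, a2⟩ := abs_le.1 i3
  obtain ⟨b1, b2⟩ := abs_le.1 i4
  have c1 := sq_nonneg ((x : ℝ) - y)
  have c2 := sq_nonneg ((x : ℝ) + y)
  have key : |2 * (z : ℝ)| ≤ 2 * γ * ((w.length : ℝ) + r.length) ^ 2
      + K * ((w.length : ℝ) + r.length) + (8 * K ^ 2 * M ^ 2 + 1) * s := by
    rw [abs_le]
    constructor <;> linarith
  rw [abs_mul, abs_two, hsz, ← hqγ] at key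
  have fin := le_add_of_sq_le (s := s) (N := (w.length : ℝ) + r.length) (a := K / 2)
    (b := (8 * K ^ 2 * M ^ 2 + 1) / 2) hq0 (by positivity) (by positivity) (by positivity)
    (by linarith)
  rw [Real.sqrt_div (abs_nonneg _), ← hs, ← hq, div_le_iff₀ hq0, add_mul, div_mul_cancel₀ _ hq0.ne']
  linarith

end Heis

/-! ### Combining the two bounds. -/

theorem proposition5p1 (S : Set Heis) (hfin : S.Finite) (hsymm : ∀ s ∈ S, s⁻¹ ∈ S)
    (hgen : Subgroup.closure S = ⊤) :
    ∃ L C : ℝ, 0 ≤ L ∧ 0 ≤ C ∧ ∀ x y z : ℤ,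
      L * max ((x : ℝ) ^ 4) ((y : ℝ) ^ 4) ≤ |(z : ℝ)| →
        |(wordNorm S ⟨x, y, z⟩ : ℝ) -
            (Real.sqrt (|(z : ℝ)| / isoperimetricConstant (Heis.proj '' S)) -
              (addWordNorm (Heis.proj '' S) (x, y) : ℝ))| ≤ C := by
  have hV := Heis.spans_proj hsymm hgen
  have hneg := Heis.neg_mem_proj hsymm
  have hVfin := hfin.image Heis.proj
  obtain ⟨u, hu, v, hv, huv⟩ := hV.exists_planeDet_pos hneg
  obtain ⟨K, hK1, hK⟩ := Heis.exists_coordBound hfin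
  have hγ := isoperimetricConstant_pos hVfin hu hv (hneg u hu) (hneg v hv) huv
  obtain ⟨Ω, hΩ⟩ := WeightedWord.exists_isOptimal hVfin hu hv (hneg u hu) (hneg v hv) huv
  have hγΩ := hΩ.isoperimetricConstant_le
  have hδ := hΩ.area2_pos
  obtain ⟨C₁, hC₁⟩ := Heis.exists_lower_bound hfin hsymm hgen hK1 hK hγ
  -- Chosen so that |z| = (Bn)² for the scale n below; then x⁴ ≤ |z| reads x² ≤ Bn, and L = 1
  -- suffices.
  set B := Real.sqrt (Ω.area2 / 2) with hB
  have hB0 : 0 ≤ B := Real.sqrt_nonneg _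
  have hB2 : B ^ 2 = Ω.area2 / 2 := Real.sq_sqrt (by positivity)
  obtain ⟨N, C₂, hC₂⟩ := Heis.exists_upper_bound hsymm hgen hK1 hK hΩ hB0
  obtain ⟨C₃, hC₃0, hC₃⟩ := Heis.exists_bound_on_box
    (fun g => wordNorm S g + addWordNorm (Heis.proj '' S) (g.x, g.y))
    (max (B * N) ((B * N) ^ 2))
  refine ⟨1, max C₁ (max C₂ C₃), zero_le_one,
    hC₃0.trans ((le_max_right _ _).trans (le_max_right _ _)), fun x y z h => ?_⟩
  rw [one_mul, max_le_iff] at h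
  obtain ⟨hx, hy⟩ := h
  have lower := hC₁ x y z hx hy
  set n := Real.sqrt (2 * |(z : ℝ)| / Ω.area2) with hn
  have hn0 : 0 ≤ n := Real.sqrt_nonneg _
  have hn2 : n ^ 2 * Ω.area2 = 2 * |(z : ℝ)| := by
    rw [hn, Real.sq_sqrt (by positivity)]
    field_simp
  have hBn : |(z : ℝ)| = (B * n) ^ 2 := by rw [mul_pow, hB2]; linarith
  have hBn0 : 0 ≤ B * n := by positivity
  have hx2 := sq_le_of_pow_four_le hBn0 hx hBn
  have hy2 := sq_le_of_pow_four_le hBn0 hy hBn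
  -- Only γ ≤ `Ω.area2 / 2` is needed: the lower bound is already stated with γ itself.
  have hnγ : n ≤ Real.sqrt (|(z : ℝ)| / isoperimetricConstant (Heis.proj '' S)) := by
    refine Real.sqrt_le_sqrt ?_
    rw [div_le_div_iff₀ hδ hγ]
    nlinarith [abs_nonneg (z : ℝ)]
  have upper : (wordNorm S ⟨x, y, z⟩ : ℝ) ≤
      Real.sqrt (|(z : ℝ)| / isoperimetricConstant (Heis.proj '' S)) -
        addWordNorm (Heis.proj '' S) (x, y) + max C₂ C₃ := by
    rcases le_total N n with hN | hN
    · have : (wordNorm S ⟨x, y, z⟩ : ℝ) ≤ n - addWordNorm (Heis.proj '' S) (x, y) + C₂ := by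
        rcases abs_choice (z : ℝ) with hz | hz
        · exact hC₂ n 1 x y z hN hn0 hx2 hy2 (Or.inl rfl) (by rw [hn2, hz]; ring)
        · exact hC₂ n (-1) x y z hN hn0 hx2 hy2 (Or.inr rfl) (by rw [hn2, hz]; ring)
      linarith [le_max_left C₂ C₃]
    -- Below the threshold N all three coordinates are bounded, so finitely many elements remain.
    · have hle : B * n ≤ B * N := by gcongr
      have small : ∀ t : ℤ, (t : ℝ) ^ 2 ≤ B * n → |(t : ℝ)| ≤ B * N := by
        intro t ht
        have h1 : |t| ≤ t ^ 2 := by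
          rw [← sq_abs]
          exact Int.le_self_sq _
        have h2 : |(t : ℝ)| ≤ (t : ℝ) ^ 2 := by exact_mod_cast h1
        linarith
      have := hC₃ ⟨x, y, z⟩ ((small x hx2).trans (le_max_left _ _))
        ((small y hy2).trans (le_max_left _ _))
        (by rw [hBn]; exact (pow_le_pow_left₀ hBn0 hle 2).trans (le_max_right _ _))
      push_cast at this
      linarith [le_max_right C₂ C₃]
  rw [abs_le]
  constructor
  · linarith [le_max_left C₁ (max C₂ C₃)]
  · linarith [le_max_right C₁ (max C₂ C₃)]
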